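/- **Setting.** An instance consists of a finite set $J$ of jobs, where job $j$ has a release time $r_j\in\mathbb N$, a deadline $d_j\in\mathbb N$ and a processing volume $p_j\in\mathbb N$, a number $m\ge 1$ of processors, and a real number $q\ge 0$. Let $d=\max_j d_j$, $T=\{0,\dots,d\}$ (the time slots), $E_j=\{t : r_j\le t\le d_j\}$ and $P=\sum_j p_j$. A feasible schedule assigns to each processor in each slot at most one job such that every job $j$ is processed in exactly $p_j$ slots, all in $E_j$, and never by two processors in the same slot (preemption and migration are allowed). A processor is busy at $t$ if it works on a job at $t$, and idle otherwise; $v(t)$ is the number of busy processors at $t$. The busy (idle, on) intervals of a processor are the inclusion-maximal nonempty intervals $N\subseteq T$ throughout which it is busy (idle, on). **Energy.** Each processor is on or off in each slot, must be on when busy, and is off before slot $0$. The energy is $1$ per processor and slot in the on-state plus $q$ each time a processor is turned on, i.e. $\sum_k\sum_{N\text{ on interval of }k}(|N|+q)$. $\mathrm{OPT}$ is the minimum energy over all feasible schedules and all admissible choices of on-states. A schedule that only says which processor is busy when is given the following on-states: a processor is off before its first and after its last busy slot and during the idle intervals in between that are longer than $q$, and on otherwise. **Interval costs.** For a feasible schedule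 $S$ let $\mathrm{costs}(S)=\sum_{k}\bigl(\sum_{B}|B|+\sum_{N}\min\{|N|,q\}\bigr)$, where $B$ and $N$ run over all busy and all idle intervals in $T$ of processor $k$ (initial and final idle intervals included), and let $\mathrm{OPT}'$ be the minimum of $\mathrm{costs}$ over all feasible schedules. **Algorithm PLTR.** Keep bounds $l_t\le v(t)\le m_t$, initially $l_t=0$, $m_t=m$ for all $t\in T$. For $k=m,m-1,\dots,1$: set $t:=0$ and, while $t\le d$, do the following two steps. 1. Find the maximal $t'\in\{t,\dots,d+1\}$ such that there is a feasible schedule respecting the current bounds with $m_s$ replaced by $k-1$ for all $s\in[t,t')$; make this replacement and set $t:=t'$. 2. Find the maximal $t'\in\{t,\dots,d+1\}$ such that there is a feasible schedule respecting the current bounds with $l_s$ replaced by $\max\{k,l_s\}$ for all $s\in[t,t')$; make this replacement and set $t:=t'$. Finally, return a feasible schedule $S$ that respects the final bounds and uses lower-numbered processors first (if processor $k$ is busy at $t$, so is every processor $k'\le k$). **Theorem.** If the instance has a feasible schedule, then PLTR constructs a (feasible) schedule, and every schedule $S$ that it can return has energy at most $2\,\mathrm{OPT}+P$. Likewise $\mathrm{costs}(S)\le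 2\,\mathrm{OPT}'+P$. -/

import Mathlib

namespace PowerDown

/-- An instance: jobs with release time, deadline and processing volume, the number of
processors, and the energy needed for turning a processor on. -/
structure Instance (J : Type*) where
  release : J → ℕ
  deadline : J → ℕ
  volume : J → ℕ
  procs : ℕ
  one_le_procs : 1 ≤ procs
  wake : ℝ
  wake_nonneg : 0 ≤ wake

/-- `S k t = some j`: processor `k` works on job `j` in time slot `t`; `S k t = none`: processor
`k` is idle in slot `t`. Processor `k : Fin m` is the processor with number `k + 1`. -/
abbrev Assignment (m : ℕ) (J : Type*) : Type _ := Fin m → ℕ → Option J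

def Busy {m : ℕ} {J : Type*} (S : Assignment m J) (k : Fin m) (t : ℕ) : Prop :=
  ∃ j, S k t = some j

/-- The number of busy processors in slot `t`. -/
noncomputable def vol {m : ℕ} {J : Type*} (S : Assignment m J) (t : ℕ) : ℕ :=
  open scoped Classical in (Finset.univ.filter fun k : Fin m => Busy S k t).card

/-- Lower-numbered processors are used first. -/
def Stair {m : ℕ} {J : Type*} (S : Assignment m J) : Prop :=
  ∀ (t : ℕ) (k k' : Fin m), k' ≤ k → Busy S k t → Busy S k' t

/-- The inclusion-maximal nonempty intervals `{a, …, b} ⊆ {0, …, d}` on which `A` holds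
throughout, each given by its pair of end points `(a, b)`. -/
noncomputable def maxIntervals (d : ℕ) (A : ℕ → Prop) : Finset (ℕ × ℕ) :=
  open scoped Classical in
  (Finset.range (d + 1) ×ˢ Finset.range (d + 1)).filter fun N =>
    N.1 ≤ N.2 ∧ (∀ t ∈ Finset.Icc N.1 N.2, A t) ∧
      ∀ a b : ℕ, a ≤ N.1 → N.2 ≤ b → b ≤ d → (∀ t ∈ Finset.Icc a b, A t) → a = N.1 ∧ b = N.2

/-- The number of slots of the interval with end points `N.1 ≤ N.2`. -/
def len (N : ℕ × ℕ) : ℕ := N.2 + 1 - N.1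

/-- Lower and upper bounds for the number of busy processors in every slot. -/
structure Bounds where
  lo : ℕ → ℕ
  hi : ℕ → ℕ

namespace Instance

variable {J : Type*} [Fintype J] (I : Instance J)

/-- The last deadline `d`; the time slots are `0, …, d`. -/
def horizon : ℕ := Finset.univ.sup I.deadline

def slots : Finset ℕ := Finset.range (I.horizon + 1)

/-- The total processing volume `P`. -/
def totalVolume : ℕ := ∑ j, I.volume j

/-- A feasible schedule of the jobs (which processor works on which job when). -/
structure Feasible (S : Assignment I.procs J) : Prop where
  window : ∀ k t j, S k t = some j → I.release j ≤ t ∧ t ≤ I.deadline j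
  noParallel : ∀ k k' t j, S k t = some j → S k' t = some j → k = k'
  complete : ∀ j, (open scoped Classical in
    (I.slots.filter fun t => ∃ k, S k t = some j).card) = I.volume j

/-- The instance admits a feasible schedule. -/
def Solvable : Prop := ∃ S : Assignment I.procs J, I.Feasible S

/-! ### Energy -/

/-- The energy consumed when processor `k` is in the on-state exactly in the slots `t` with
`on k t`: one unit per slot in the on-state, and `q` for each maximal on-interval, because every
processor starts in the off-state and is turned on once per on-interval. -/
noncomputable def energy (on : Fin I.procs → ℕ → Prop) : ℝ :=
  ∑ k, ∑ N ∈ maxIntervals I.horizon (on k), ((len N : ℝ) + I.wake)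

/-- The energies of all feasible solutions; a solution consists of a feasible schedule of the jobs
and of the on-states of the processors, which must be on whenever they are busy. -/
def energies : Set ℝ :=
  {E | ∃ (S : Assignment I.procs J) (on : Fin I.procs → ℕ → Prop),
    I.Feasible S ∧ (∀ k t, Busy S k t → on k t) ∧ E = I.energy on}

/-- The minimum energy. -/
noncomputable def optEnergy : ℝ := sInf I.energies

/-- The on-states that go with a schedule of the jobs: a processor is off before its first and
after its last busy slot and during idle intervals in between that are longer than `q`; otherwise
it is on. -/
def onRule (S : Assignment I.procs J) (k : Fin I.procs) (t : ℕ) : Prop :=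
  Busy S k t ∨ ∃ N ∈ maxIntervals I.horizon (fun s => ¬ Busy S k s),
    t ∈ Finset.Icc N.1 N.2 ∧ 0 < N.1 ∧ N.2 < I.horizon ∧ (len N : ℝ) ≤ I.wake

/-! ### Costs of busy and idle intervals -/

/-- The costs `∑ |B| + ∑ min (|N|, q)` over all busy intervals `B` and all idle intervals `N`
(initial and final ones included) of all processors. -/
noncomputable def costs (S : Assignment I.procs J) : ℝ :=
  ∑ k, (∑ B ∈ maxIntervals I.horizon (fun t => Busy S k t), (len B : ℝ) +
    ∑ N ∈ maxIntervals I.horizon (fun t => ¬ Busy S k t), min (len N : ℝ) I.wake)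

/-- The minimum costs of a feasible schedule. -/
noncomputable def optCosts : ℝ := sInf {c | ∃ S, I.Feasible S ∧ c = I.costs S}

/-! ### The Parallel Left-to-Right algorithm -/

/-- There is a feasible schedule that respects the bounds. -/
def BoundsFeasible (b : Bounds) : Prop :=
  ∃ S : Assignment I.procs J, I.Feasible S ∧ ∀ t ∈ I.slots, b.lo t ≤ vol S t ∧ vol S t ≤ b.hi t

end Instance

namespace Bounds

/-- Set the upper bound to `k - 1` in all slots of `[t, t')`. -/
def setIdle (b : Bounds) (k t t' : ℕ) : Bounds :=
  { b with hi := fun s => if t ≤ s ∧ s < t' then k - 1 else b.hi s }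

/-- Raise the lower bound to at least `k` in all slots of `[t, t')`. -/
def setBusy (b : Bounds) (k t t' : ℕ) : Bounds :=
  { b with lo := fun s => if t ≤ s ∧ s < t' then max k (b.lo s) else b.lo s }

end Bounds

namespace Instance

variable {J : Type*} [Fintype J] (I : Instance J)

/-- The maximal `t' ∈ {t, …, d + 1}` with `A t'`. -/
noncomputable def latest (t : ℕ) (A : ℕ → Prop) : ℕ :=
  open scoped Classical in ((Finset.Icc t (I.horizon + 1)).filter A).sup id

/-- Keep processor `k` idle from slot `t` on for as long as possible. -/
noncomputable def keepIdle (k : ℕ) (s : ℕ × Bounds) : ℕ × Bounds :=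
  let t' := I.latest s.1 fun t' => I.BoundsFeasible (s.2.setIdle k s.1 t')
  (t', s.2.setIdle k s.1 t')

/-- Keep processor `k` busy from slot `t` on for as long as possible. -/
noncomputable def keepBusy (k : ℕ) (s : ℕ × Bounds) : ℕ × Bounds :=
  let t' := I.latest s.1 fun t' => I.BoundsFeasible (s.2.setBusy k s.1 t')
  (t', s.2.setBusy k s.1 t')

/-- One pass of the while-loop for processor `k`, with loop condition `t ≤ d`. -/
noncomputable def round (k : ℕ) (s : ℕ × Bounds) : ℕ × Bounds :=
  if s.1 ≤ I.horizon then I.keepBusy k (I.keepIdle k s) else s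

/-- The while-loop for processor `k`, started at `t = 0`. Every pass increases `t` (see
`lt_round`), so the loop has ended after at most `d + 1` passes (see `horizon_lt_iterate`). -/
noncomputable def sweep (k : ℕ) (b : Bounds) : Bounds :=
  ((I.round k)^[I.horizon + 1] (0, b)).2

/-- The outer loop, for processors `k, k - 1, …, 1`. -/
noncomputable def sweepDown : ℕ → Bounds → Bounds
  | 0, b => b
  | k + 1, b => sweepDown k (I.sweep (k + 1) b)

/-- The bounds with which the algorithm ends. -/
noncomputable def pltrBounds : Bounds :=
  I.sweepDown I.procs { lo := fun _ => 0, hi := fun _ => I.procs }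

/-- `S` is a schedule constructed by the algorithm: a feasible schedule that respects the final
bounds and uses the lower-numbered processors first. -/
def IsPLTRSchedule (S : Assignment I.procs J) : Prop :=
  I.Feasible S ∧ (∀ t ∈ I.slots, I.pltrBounds.lo t ≤ vol S t ∧ vol S t ≤ I.pltrBounds.hi t) ∧
    Stair S

/-! ### Helper facts: the definitions above do what they say -/

theorem latest_spec {t : ℕ} (A : ℕ → Prop) (ht : t ≤ I.horizon + 1) (hA : A t) :
    t ≤ I.latest t A ∧ I.latest t A ≤ I.horizon + 1 ∧ A (I.latest t A) ∧
      ∀ s, s ≤ I.horizon + 1 → t ≤ s → A s → s ≤ I.latest t A := by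
  classical
  have hne : ((Finset.Icc t (I.horizon + 1)).filter A).Nonempty :=
    ⟨t, by simp [ht, hA]⟩
  obtain ⟨x, hx, hxe⟩ := Finset.exists_mem_eq_sup _ hne (id : ℕ → ℕ)
  have hl : I.latest t A = x := by
    have hxe' : _ = x := hxe
    unfold latest
    convert hxe'
  have hub : ∀ s, s ≤ I.horizon + 1 → t ≤ s → A s → s ≤ I.latest t A := by
    intro s h1 h2 h3
    have : id s ≤ ((Finset.Icc t (I.horizon + 1)).filter A).sup id :=
      Finset.le_sup (by simp [h1, h2, h3])
    rw [hl]
    rw [hxe] at this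
    exact this
  simp only [Finset.mem_filter, Finset.mem_Icc] at hx
  refine ⟨?_, ?_, ?_, hub⟩
  · rw [hl]; exact hx.1.1
  · rw [hl]; exact hx.1.2
  · rw [hl]; exact hx.2

/-- Every pass of the while-loop keeps the bounds feasible and increases `t`. -/
theorem lt_round {k t : ℕ} (hk : 1 ≤ k) (b : Bounds) (hb : I.BoundsFeasible b)
    (ht : t ≤ I.horizon) :
    t < (I.round k (t, b)).1 ∧ I.BoundsFeasible (I.round k (t, b)).2 := by
  have e1 : b.setIdle k t t = b := by
    cases b
    simp only [Bounds.setIdle, Bounds.mk.injEq, true_and]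
    funext s
    exact if_neg (by omega)
  obtain ⟨h1, h2, h3, h4⟩ := I.latest_spec
    (fun t' => I.BoundsFeasible (b.setIdle k t t')) (t := t) (by omega) (by simpa [e1] using hb)
  have e : I.keepIdle k (t, b) = (I.latest t (fun t' => I.BoundsFeasible (b.setIdle k t t')),
    b.setIdle k t (I.latest t (fun t' => I.BoundsFeasible (b.setIdle k t t')))) := rfl
  rw [round, if_pos ht, e]
  generalize I.latest t (fun t' => I.BoundsFeasible (b.setIdle k t t')) = t₁ at *
  generalize hb1 : b.setIdle k t t₁ = b₁ at *
  have e2 : b₁.setBusy k t₁ t₁ = b₁ := by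
    cases b₁
    simp only [Bounds.setBusy, Bounds.mk.injEq, and_true]
    funext s
    exact if_neg (by omega)
  obtain ⟨g1, -, g3, g4⟩ := I.latest_spec
    (fun t' => I.BoundsFeasible (b₁.setBusy k t₁ t')) (t := t₁) h2
    (by simpa [e2, hb1] using h3)
  have e' : I.keepBusy k (t₁, b₁) = (I.latest t₁ (fun t' => I.BoundsFeasible (b₁.setBusy k t₁ t')),
    b₁.setBusy k t₁ (I.latest t₁ (fun t' => I.BoundsFeasible (b₁.setBusy k t₁ t')))) := rfl
  rw [e']
  refine ⟨?_, g3⟩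
  by_cases hd : I.horizon < t₁
  · exact lt_of_lt_of_le (lt_of_le_of_lt ht hd) g1
  · have hd' : t₁ ≤ I.horizon := not_lt.mp hd
    obtain ⟨S, hS, hSb⟩ := h3
    have hvol : k ≤ vol S t₁ := by
      by_contra hlt
      have := h4 (t₁ + 1) (by omega) (by omega) ⟨S, hS, fun s hs => by
        have hs' := hSb s hs
        subst hb1
        simp only [Bounds.setIdle] at hs' ⊢
        refine ⟨hs'.1, ?_⟩
        by_cases hst : s = t₁
        · subst hst
          rw [if_pos (by omega)]
          omega
        · have h0 := hs'.2
          split_ifs at h0 ⊢ <;> omega⟩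
      omega
    have := g4 (t₁ + 1) (by omega) (by omega) ⟨S, hS, fun s hs => by
      have hs' := hSb s hs
      simp only [Bounds.setBusy]
      refine ⟨?_, hs'.2⟩
      by_cases hst : s = t₁
      · subst hst
        rw [if_pos (by omega)]
        exact max_le hvol hs'.1
      · rw [if_neg (by omega)]
        exact hs'.1⟩
    show t < _
    omega

/-- After `d + 1` passes the while-loop for processor `k` has ended. -/
theorem horizon_lt_iterate {k : ℕ} (hk : 1 ≤ k) (b : Bounds) (hb : I.BoundsFeasible b) :
    I.horizon < ((I.round k)^[I.horizon + 1] (0, b)).1 := by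
  have key : ∀ n, (n ≤ ((I.round k)^[n] (0, b)).1 ∨ I.horizon < ((I.round k)^[n] (0, b)).1) ∧
      I.BoundsFeasible ((I.round k)^[n] (0, b)).2 := by
    intro n
    induction n with
    | zero => exact ⟨Or.inl (Nat.zero_le _), hb⟩
    | succ n ih =>
      rw [Function.iterate_succ_apply']
      generalize (I.round k)^[n] (0, b) = s at ih ⊢
      obtain ⟨t, c⟩ := s
      by_cases ht : t ≤ I.horizon
      · have h := I.lt_round hk c ih.2 ht
        refine ⟨Or.inl ?_, h.2⟩
        rcases ih.1 with h' | h' <;> simp only at h' <;> omega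
      · have hr : I.round k (t, c) = (t, c) := if_neg ht
        rw [hr]
        exact ⟨Or.inr (not_le.mp ht), ih.2⟩
  rcases (key (I.horizon + 1)).1 with h | h <;> omega

theorem finite_of_intervals {ι : Type*} (f : (Fin I.procs → Finset (ℕ × ℕ)) → ℝ)
    (g : ι → Fin I.procs → ℕ → Prop) (s : Set ι) :
    ((fun x => f fun k => maxIntervals I.horizon (g x k)) '' s).Finite := by
  classical
  refine Set.Finite.subset (Set.Finite.image f (Finset.finite_toSet
    (Fintype.piFinset fun _ : Fin I.procs =>
      (Finset.range (I.horizon + 1) ×ˢ Finset.range (I.horizon + 1)).powerset))) ?_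
  rintro _ ⟨x, -, rfl⟩
  refine ⟨_, ?_, rfl⟩
  simp only [Finset.mem_coe, Fintype.mem_piFinset, Finset.mem_powerset]
  intro k
  exact Finset.filter_subset _ _

/-- The minimum energy is attained. -/
theorem isLeast_optEnergy (h : I.Solvable) : IsLeast I.energies I.optEnergy := by
  have hfin : I.energies.Finite := by
    refine Set.Finite.subset (I.finite_of_intervals
      (fun F => ∑ k, ∑ N ∈ F k, ((len N : ℝ) + I.wake)) id Set.univ) ?_
    rintro _ ⟨S, on, -, -, rfl⟩
    exact ⟨on, trivial, rfl⟩
  obtain ⟨S, hS⟩ := h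
  have hne : I.energies.Nonempty := ⟨_, S, _, hS, fun _ _ h => h, rfl⟩
  exact ⟨hne.csInf_mem hfin, fun _ hx => csInf_le hfin.bddBelow hx⟩

/-- The minimum costs are attained. -/
theorem isLeast_optCosts (h : I.Solvable) :
    IsLeast {c | ∃ S, I.Feasible S ∧ c = I.costs S} I.optCosts := by
  have hfin : {c | ∃ S, I.Feasible S ∧ c = I.costs S}.Finite := by
    have h1 := I.finite_of_intervals (fun F => ∑ k, ∑ B ∈ F k, (len B : ℝ))
      (fun S : Assignment I.procs J => fun k t => Busy S k t) Set.univ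
    have h2 := I.finite_of_intervals (fun F => ∑ k, ∑ N ∈ F k, min (len N : ℝ) I.wake)
      (fun S : Assignment I.procs J => fun k t => ¬ Busy S k t) Set.univ
    refine Set.Finite.subset (Set.Finite.image2 (fun x y => x + y) h1 h2) ?_
    rintro _ ⟨S, -, rfl⟩
    refine ⟨_, ⟨S, trivial, rfl⟩, _, ⟨S, trivial, rfl⟩, ?_⟩
    exact Finset.sum_add_distrib.symm
  obtain ⟨S, hS⟩ := h
  have hne : {c | ∃ S, I.Feasible S ∧ c = I.costs S}.Nonempty := ⟨_, S, hS, rfl⟩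
  exact ⟨hne.csInf_mem hfin, fun _ hx => csInf_le hfin.bddBelow hx⟩

end Instance

end PowerDown

namespace PowerDown

/-! ### Schedules as the sets of jobs processed in the slots -/

section Volume

variable {J : Type*}

/-! Let `v` count the busy processors of the returned schedule and `n` the processors in the
on-state of a competing solution. Since lower-numbered processors are used first, the processor of
level `k` is idle exactly where `v ≤ k`.

The greedy choices enter through an exchange argument. Work can be shifted along chains of slots. If
`v` rises at `b`, a slot reachable from `b` has load at least `v b - 1`, and at least `v b` if it is
not before `b`; otherwise a unit could leave `b` and an idle stretch of the algorithm could be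
prolonged (`Instance.Stable`). A job with work in the reachable set already occupies all slots of
its window outside that set. So, on the reachable slots of an interval bounded by unreachable ones,
another schedule can do less only through jobs that run at the boundary
(`Instance.SlotFeasible.sum_card_le`). Averaging yields `Dominates`: if `v` is low at `t` and `t'`
and exceeds `k` in between, then `k < n s + v t + v t'` for some `s` in between.

Now idle intervals of level `k` are charged. If `k < n + 2 * v` holds throughout, the length pays; a
slot is used in this way on at most `n + v` levels, and the sum of `n + v` is at most twice that of
`n`, because all feasible schedules process the same volume. Every other interval is low and costs
at most `q`. In it take `t` with `n t + 2 * v t ≤ k` and `v t` minimal, and charge the first later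
slot where `n` exceeds `k - 2 * v t`. By domination no two distinct low intervals share a charge,
except on level 0, where at most two do (`card_charged_le_two`). So there are at most twice as many
low intervals as off-intervals of the levels of `n`, which gives the bound on the costs; the busy
slots contribute the extra `P`.

For the energy, initial and final idle intervals are free, but every processor in use is woken once
more. The first rise of `n` on each level receives no charge, and this compensates
(`sum_card_inner_lowIntervals_le`). -/

theorem vol_le_procs {m : ℕ} (S : Assignment m J) (t : ℕ) : vol S t ≤ m := by
  classical
  exact (Finset.card_filter_le _ _).trans (by simp)

/-- For busy processors sorted by number, processor `k` is busy iff `k` is less than the number of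
busy processors. -/
theorem Stair.busy_iff {m : ℕ} {S : Assignment m J} (hS : Stair S) (k : Fin m) (t : ℕ) :
    Busy S k t ↔ k.val < vol S t := by
  classical
  have hv : vol S t = (Finset.univ.filter fun k : Fin m => Busy S k t).card := by
    unfold vol
    congr
  constructor
  · intro h
    have hsub : Finset.Iic k ⊆ Finset.univ.filter fun k : Fin m => Busy S k t := by
      intro k' hk'
      simpa using hS t k k' (Finset.mem_Iic.1 hk') h
    have := Finset.card_le_card hsub
    rw [Fin.card_Iic] at this
    omega
  · intro h
    by_contra hb
    have hsub : (Finset.univ.filter fun k : Fin m => Busy S k t) ⊆ Finset.Iio k := by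
      intro k' hk'
      rw [Finset.mem_Iio]
      by_contra hlt
      exact hb (hS t k' k (not_lt.1 hlt) (Finset.mem_filter.1 hk').2)
    have := Finset.card_le_card hsub
    rw [Fin.card_Iio] at this
    omega

end Volume

section Slots

variable {J : Type*} [Fintype J]

open Classical in
/-- The jobs processed in slot `t`. -/
noncomputable def jobsAt {m : ℕ} (S : Assignment m J) (t : ℕ) : Finset J :=
  Finset.univ.filter fun j => ∃ k, S k t = some j

theorem mem_jobsAt {m : ℕ} {S : Assignment m J} {t : ℕ} {j : J} :
    j ∈ jobsAt S t ↔ ∃ k, S k t = some j := by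
  simp [jobsAt]

open Classical in
/-- The sets `x t` of jobs respect all windows and volumes; the number of processors is ignored. -/
structure Instance.SlotFeasible (I : Instance J) (x : ℕ → Finset J) : Prop where
  window : ∀ t, ∀ j ∈ x t, I.release j ≤ t ∧ t ≤ I.deadline j
  complete : ∀ j, (I.slots.filter fun t => j ∈ x t).card = I.volume j

variable {I : Instance J}

theorem Instance.mem_slots {t : ℕ} : t ∈ I.slots ↔ t ≤ I.horizon := by
  simp [Instance.slots]

theorem Instance.deadline_le_horizon (j : J) : I.deadline j ≤ I.horizon :=
  Finset.le_sup (f := I.deadline) (Finset.mem_univ j)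

theorem Instance.SlotFeasible.le_horizon {x : ℕ → Finset J} (hx : I.SlotFeasible x) {t : ℕ} {j : J}
    (hj : j ∈ x t) : t ≤ I.horizon :=
  (hx.window t j hj).2.trans (I.deadline_le_horizon j)

theorem Instance.Feasible.slotFeasible {S : Assignment I.procs J} (hS : I.Feasible S) :
    I.SlotFeasible (jobsAt S) where
  window t j hj := by
    obtain ⟨k, hk⟩ := mem_jobsAt.1 hj
    exact hS.window k t j hk
  complete j := by
    rw [← hS.complete j]
    congr 1
    ext t
    simp only [Finset.mem_filter, mem_jobsAt]

theorem Instance.Feasible.vol_eq {S : Assignment I.procs J} (hS : I.Feasible S) (t : ℕ) :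
    vol S t = (jobsAt S t).card := by
  classical
  unfold vol
  refine Finset.card_bij (fun k hk => (Finset.mem_filter.1 hk).2.choose) ?_ ?_ ?_
  · intro k hk
    exact mem_jobsAt.2 ⟨k, (Finset.mem_filter.1 hk).2.choose_spec⟩
  · intro k hk k' hk' h
    have h1 := (Finset.mem_filter.1 hk).2.choose_spec
    have h2 := (Finset.mem_filter.1 hk').2.choose_spec
    rw [← h] at h2
    exact hS.noParallel k k' t _ h1 h2
  · intro j hj
    obtain ⟨k, hk⟩ := mem_jobsAt.1 hj
    have hk' : k ∈ Finset.univ.filter fun k => Busy S k t := by simpa using ⟨j, hk⟩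
    refine ⟨k, by simpa using hk', ?_⟩
    have := (Finset.mem_filter.1 hk').2.choose_spec
    exact Option.some.inj (this.symm.trans hk)

/-- Processing the jobs of every slot on the lowest-numbered processors. -/
theorem Instance.SlotFeasible.exists_stair {x : ℕ → Finset J} (hx : I.SlotFeasible x)
    (hm : ∀ t, (x t).card ≤ I.procs) :
    ∃ S : Assignment I.procs J, I.Feasible S ∧ Stair S ∧ ∀ t, vol S t = (x t).card := by
  classical
  let S : Assignment I.procs J := fun k t =>
    if h : k.val < (x t).card then some ((x t).equivFin.symm ⟨k, h⟩).1 else none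
  have hS : ∀ k t j, S k t = some j ↔ ∃ h : k.val < (x t).card,
      ((x t).equivFin.symm ⟨k, h⟩).1 = j := by
    intro k t j
    simp only [S]
    split_ifs with h
    · simp [h]
    · simp [h]
  have hmem : ∀ k t j, S k t = some j → j ∈ x t := by
    intro k t j h
    obtain ⟨h', rfl⟩ := (hS k t j).1 h
    exact ((x t).equivFin.symm ⟨k, h'⟩).2
  have hex : ∀ t j, (∃ k, S k t = some j) ↔ j ∈ x t := by
    intro t j
    refine ⟨fun ⟨k, hk⟩ => hmem k t j hk, fun h => ?_⟩
    let i := (x t).equivFin ⟨j, h⟩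
    refine ⟨⟨i.1, i.2.trans_le (hm t)⟩, (hS _ _ _).2 ⟨i.2, ?_⟩⟩
    simp [i]
  have hfeas : I.Feasible S := by
    refine ⟨fun k t j h => hx.window t j (hmem k t j h), ?_, ?_⟩
    · intro k k' t j h h'
      obtain ⟨h1, e1⟩ := (hS _ _ _).1 h
      obtain ⟨h2, e2⟩ := (hS _ _ _).1 h'
      have := (x t).equivFin.symm.injective (Subtype.ext (e1.trans e2.symm))
      exact Fin.ext (by simpa using this)
    · intro j
      rw [← hx.complete j]
      simp only [hex]
  have hjobs : ∀ t, jobsAt S t = x t := fun t => Finset.ext fun j => mem_jobsAt.trans (hex t j)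
  refine ⟨S, hfeas, ?_, fun t => by rw [hfeas.vol_eq, hjobs]⟩
  rintro t k k' hk ⟨j, hj⟩
  obtain ⟨h, -⟩ := (hS _ _ _).1 hj
  exact ⟨_, (hS _ _ _).2 ⟨lt_of_le_of_lt hk h, rfl⟩⟩

theorem Instance.Feasible.exists_stair {S : Assignment I.procs J} (hS : I.Feasible S) :
    ∃ S' : Assignment I.procs J, I.Feasible S' ∧ Stair S' ∧ ∀ t, vol S' t = vol S t := by
  obtain ⟨S', h1, h2, h3⟩ := hS.slotFeasible.exists_stair fun t => by
    rw [← hS.vol_eq]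
    exact vol_le_procs S t
  exact ⟨S', h1, h2, fun t => by rw [h3, hS.vol_eq]⟩

theorem Instance.Feasible.sum_vol {S : Assignment I.procs J} (hS : I.Feasible S) :
    ∑ t ∈ I.slots, vol S t = I.totalVolume := by
  classical
  have h1 : ∀ t ∈ I.slots, vol S t = ∑ j, if j ∈ jobsAt S t then 1 else 0 := by
    intro t _
    rw [hS.vol_eq]
    simp
  rw [Finset.sum_congr rfl h1, Finset.sum_comm]
  refine Finset.sum_congr rfl fun j _ => ?_
  rw [← hS.slotFeasible.complete j, Finset.card_filter]

/-! ### Exchanging slots -/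

/-- Some job processed in slot `u` may be moved to slot `w`. -/
def Instance.Movable (I : Instance J) (x : ℕ → Finset J) (u w : ℕ) : Prop :=
  ∃ j ∈ x u, j ∉ x w ∧ I.release j ≤ w ∧ w ≤ I.deadline j

theorem Instance.SlotFeasible.move {x : ℕ → Finset J} (hx : I.SlotFeasible x) {u w : ℕ} {j : J}
    (hu : j ∈ x u) (hw : j ∉ x w) (h1 : I.release j ≤ w) (h2 : w ≤ I.deadline j) :
    ∃ y, I.SlotFeasible y ∧ (∀ t, t ≠ u → t ≠ w → y t = x t) ∧ y u ⊆ x u ∧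
      (y u).card + 1 = (x u).card ∧ (y w).card = (x w).card + 1 := by
  classical
  have huw : u ≠ w := fun h => hw (h ▸ hu)
  refine ⟨fun t => if t = u then (x u).erase j else if t = w then insert j (x w) else x t,
    ⟨?_, ?_⟩, ?_, ?_, ?_, ?_⟩
  · intro t i hi
    split_ifs at hi with e1 e2
    · subst e1
      exact hx.window t i (Finset.mem_of_mem_erase hi)
    · subst e2
      rcases Finset.mem_insert.1 hi with rfl | hi
      · exact ⟨h1, h2⟩
      · exact hx.window t i hi
    · exact hx.window t i hi
  · intro i
    rw [← hx.complete i]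
    by_cases hij : i = j
    · subst hij
      have hus : u ∈ I.slots.filter fun t => i ∈ x t := by
        simp [Instance.mem_slots, hu, hx.le_horizon hu]
      have : (I.slots.filter fun t => i ∈ (if t = u then (x u).erase i else
          if t = w then insert i (x w) else x t)) =
          insert w ((I.slots.filter fun t => i ∈ x t).erase u) := by
        ext t
        simp only [Finset.mem_filter, Finset.mem_insert, Finset.mem_erase]
        by_cases e1 : t = u
        · subst e1
          simp [huw]
        · by_cases e2 : t = w
          · subst e2
            simp [e1, Instance.mem_slots, h2.trans (I.deadline_le_horizon i)]
          · simp [e1, e2]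
      rw [Finset.card_bij (fun a _ => a) (t := insert w ((I.slots.filter fun t => i ∈ x t).erase u))]
      · rw [Finset.card_insert_of_notMem (by simp [hw]), Finset.card_erase_add_one hus]
      · intro a ha
        rw [← this]
        simpa using ha
      · intro a _ b _ h
        exact h
      · intro a ha
        rw [← this] at ha
        exact ⟨a, by simpa using ha, rfl⟩
    · congr 1
      apply Finset.filter_congr
      intro t _
      split_ifs with e1 e2
      · subst e1
        simp [hij]
      · subst e2
        simp [hij]
      · rfl
  · intro t h h'
    simp [h, h']
  · simp [Finset.erase_subset]
  · simp [Finset.card_erase_add_one hu]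
  · simp [huw.symm, hw]

/-- Cutting a chain at its last visit to `a` leaves a remainder that avoids `a`, so chains may be
treated as simple paths. -/
theorem reflTransGen_avoid {α : Type*} {r : α → α → Prop} {a z : α}
    (h : Relation.ReflTransGen r a z) :
    a = z ∨ ∃ c, r a c ∧ Relation.ReflTransGen (fun u w => r u w ∧ w ≠ a) c z := by
  induction h with
  | refl => exact Or.inl rfl
  | @tail y z _ hyz ih =>
    by_cases hz : z = a
    · exact Or.inl hz.symm
    · rcases ih with rfl | ⟨c, hc, hcy⟩
      · exact Or.inr ⟨z, hyz, .refl⟩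
      · exact Or.inr ⟨c, hc, hcy.tail ⟨hyz, hz⟩⟩

/-- The chain is processed from its far end: its tail avoids `b` and is handled by induction on the
allowed set, then the first move is made. The clause `y b ⊆ x b`, applied to the second slot of the
chain, ensures that the job leaving `b` is still absent there. -/
theorem Instance.SlotFeasible.exchange_aux (n : ℕ) : ∀ (A : Finset ℕ) (x : ℕ → Finset J) (b s : ℕ),
    A.card = n → I.SlotFeasible x → b ∈ A →
    Relation.ReflTransGen (fun u w => I.Movable x u w ∧ w ∈ A) b s →
    ∃ y, I.SlotFeasible y ∧ (∀ t, t ∉ A → y t = x t) ∧ y b ⊆ x b ∧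
      ∀ t, (y t).card + (if t = b then 1 else 0) = (x t).card + (if t = s then 1 else 0) := by
  induction n with
  | zero =>
    intro A x b s hA _ hb
    rw [Finset.card_eq_zero.1 hA] at hb
    exact absurd hb (Finset.notMem_empty _)
  | succ n ih =>
    intro A x b s hA hx hb hr
    rcases reflTransGen_avoid hr with rfl | ⟨c, ⟨⟨j, hjb, hjc, h1, h2⟩, hcA⟩, hcs⟩
    · exact ⟨x, hx, fun _ _ => rfl, Finset.Subset.refl _, fun _ => rfl⟩
    have hcb : c ≠ b := fun h => hjc (h ▸ hjb)
    obtain ⟨y, hy, hyA, hyc, hcard⟩ := ih (A.erase b) x c s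
      (by rw [Finset.card_erase_of_mem hb, hA]; rfl) hx (Finset.mem_erase.2 ⟨hcb, hcA⟩)
      (Relation.ReflTransGen.mono (fun u w h => ⟨h.1.1, Finset.mem_erase.2 ⟨h.2, h.1.2⟩⟩) _ _ hcs)
    have hyb : y b = x b := hyA b (Finset.notMem_erase _ _)
    obtain ⟨z, hz, hz1, hz2, hz3, hz4⟩ := hy.move (u := b) (w := c) (j := j) (hyb ▸ hjb)
      (fun h => hjc (hyc h)) h1 h2
    refine ⟨z, hz, fun t ht => ?_, hyb ▸ hz2, fun t => ?_⟩
    · rw [hz1 t (fun h => ht (h ▸ hb)) (fun h => ht (h ▸ hcA)), hyA t]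
      exact fun h => ht (Finset.mem_of_mem_erase h)
    · have := hcard t
      by_cases e1 : t = b
      · subst e1
        rw [if_neg hcb.symm] at this
        rw [if_pos rfl, ← this, hz3, add_zero]
      · rw [if_neg e1]
        by_cases e2 : t = c
        · subst e2
          rw [if_pos rfl] at this
          rw [← this, hz4]
        · rw [hz1 t e1 e2, ← this, if_neg e2]

theorem Instance.Movable.le_horizon {x : ℕ → Finset J} {u w : ℕ} (h : I.Movable x u w) :
    w ≤ I.horizon := by
  obtain ⟨j, -, -, -, h2⟩ := h
  exact h2.trans (I.deadline_le_horizon j)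

/-- The slots to which work from slot `b` can be shifted. -/
def Instance.Reach (I : Instance J) (x : ℕ → Finset J) (b s : ℕ) : Prop :=
  Relation.ReflTransGen (I.Movable x) b s

theorem Instance.Reach.le_horizon {x : ℕ → Finset J} {b s : ℕ} (hb : b ≤ I.horizon)
    (h : I.Reach x b s) : s ≤ I.horizon := by
  rcases h.cases_tail with rfl | ⟨c, -, hc⟩
  · exact hb
  · exact hc.le_horizon

theorem Instance.SlotFeasible.exchange {x : ℕ → Finset J} (hx : I.SlotFeasible x) {b s : ℕ}
    (hb : b ≤ I.horizon) (h : I.Reach x b s) :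
    ∃ y, I.SlotFeasible y ∧
      ∀ t, (y t).card + (if t = b then 1 else 0) = (x t).card + (if t = s then 1 else 0) := by
  obtain ⟨y, hy, -, -, h⟩ := Instance.SlotFeasible.exchange_aux _ I.slots x b s rfl hx
    (Instance.mem_slots.2 hb) (Relation.ReflTransGen.mono (fun u w h => ⟨h, Instance.mem_slots.2 h.le_horizon⟩) _ _ h)
  exact ⟨y, hy, h⟩

/-- Exchange for schedules: one unit of work is shifted from slot `b` to slot `s`. -/
theorem Instance.Feasible.exchange {S : Assignment I.procs J} (hS : I.Feasible S) {b s : ℕ}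
    (hb : b ≤ I.horizon) (h : I.Reach (jobsAt S) b s) (hs : vol S s < I.procs) :
    ∃ S' : Assignment I.procs J, I.Feasible S' ∧
      ∀ t, vol S' t + (if t = b then 1 else 0) = vol S t + (if t = s then 1 else 0) := by
  obtain ⟨y, hy, hc⟩ := hS.slotFeasible.exchange hb h
  obtain ⟨S', h1, -, h3⟩ := hy.exists_stair fun t => by
    have h1 := hc t
    have h2 := vol_le_procs S t
    rw [← hS.vol_eq] at h1
    by_cases e : t = s
    · subst e
      rw [if_pos rfl] at h1
      omega
    · rw [if_neg e] at h1
      omega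
  exact ⟨S', h1, fun t => by rw [h3, hc, hS.vol_eq]⟩

/-! ### Comparing two schedules on a set of slots -/

/-- If work from the slots in `Q` can only be shifted to slots in `Q` and every job whose window
meets an interval `W` but is not contained in `W` can be processed in a slot of `C`, then, on
average over `Q ∩ W`, every schedule has at least the volume of `x` less that of `x` on `C`. -/
theorem Instance.SlotFeasible.sum_card_le {x y : ℕ → Finset J} (hx : I.SlotFeasible x)
    (hy : I.SlotFeasible y) (Q C W M : Finset ℕ)
    (hM : ∀ t, t ∈ M ↔ t ∈ Q ∧ t ∈ W) (hMs : M ⊆ I.slots) (hQ : ∀ u ∈ Q, ∀ w, I.Movable x u w → w ∈ Q)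
    (hCQ : ∀ c ∈ C, c ∉ Q)
    (hC : ∀ u ∈ W, ∀ w ∈ I.slots, w ∉ W → ∃ c ∈ C, u ≤ c ∧ c ≤ w ∨ w ≤ c ∧ c ≤ u) :
    ∑ s ∈ M, (x s).card ≤ ∑ s ∈ M, (y s).card + (∑ c ∈ C, (x c).card) * M.card := by
  classical
  let B : Finset J := C.biUnion x
  have hB : B.card ≤ ∑ c ∈ C, (x c).card := Finset.card_biUnion_le
  have key : ∀ z : ℕ → Finset J, ∑ s ∈ M, (z s).card =
      ∑ j, (M.filter fun s => j ∈ z s).card := by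
    intro z
    simp only [Finset.card_filter]
    rw [Finset.sum_comm]
    simp
  rw [key, key]
  have hj : ∀ j, (M.filter fun s => j ∈ x s).card ≤
      (M.filter fun s => j ∈ y s).card + if j ∈ B then M.card else 0 := by
    intro j
    split_ifs with hjB
    · exact (Finset.card_filter_le _ _).trans (Nat.le_add_left _ _)
    rw [add_zero]
    rcases Finset.eq_empty_or_nonempty (M.filter fun s => j ∈ x s) with h0 | ⟨u, hu⟩
    · rw [h0]
      simp
    obtain ⟨huM, huj⟩ := Finset.mem_filter.1 hu
    have huQ := ((hM u).1 huM).1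
    have huW := ((hM u).1 huM).2
    -- outside of `Q` the job is processed in its whole window
    have hfull : ∀ w, I.release j ≤ w → w ≤ I.deadline j → w ∉ Q → j ∈ x w := by
      intro w h1 h2 hw
      by_contra h
      exact hw (hQ u huQ w ⟨j, huj, h, h1, h2⟩)
    have hwin := hx.window u j huj
    have hW : ∀ w, I.release j ≤ w → w ≤ I.deadline j → w ∈ W := by
      intro w h1 h2
      by_contra hw
      obtain ⟨c, hcC, hc⟩ := hC u huW w
        (Instance.mem_slots.2 (h2.trans (I.deadline_le_horizon j))) hw
      exact hjB (Finset.mem_biUnion.2 ⟨c, hcC, hfull c (by omega) (by omega) (hCQ c hcC)⟩)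
    have hsplit : ∀ z, I.SlotFeasible z → (M.filter fun s => j ∈ z s).card +
        ((I.slots \ M).filter fun s => j ∈ z s).card = I.volume j := by
      intro z hz
      rw [← hz.complete j, ← Finset.card_union_of_disjoint
        (Finset.disjoint_filter_filter Finset.disjoint_sdiff), ← Finset.filter_union,
        Finset.union_sdiff_of_subset hMs]
    have h1 := hsplit x hx
    have h2 := hsplit y hy
    -- Outside `M`, `x` processes `j` in its whole window, so `y` cannot do more there. As the
    -- volume is fixed, `y` does at least as much of `j` on `M`.
    have h3 : ((I.slots \ M).filter fun s => j ∈ y s).card ≤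
        ((I.slots \ M).filter fun s => j ∈ x s).card := by
      apply Finset.card_le_card
      intro s hs
      obtain ⟨hs1, hs2⟩ := Finset.mem_filter.1 hs
      have hw := hy.window s j hs2
      refine Finset.mem_filter.2 ⟨hs1, hfull s hw.1 hw.2 fun hsQ => ?_⟩
      exact (Finset.mem_sdiff.1 hs1).2 ((hM s).2 ⟨hsQ, hW s hw.1 hw.2⟩)
    omega
  calc _ ≤ ∑ j, ((M.filter fun s => j ∈ y s).card + if j ∈ B then M.card else 0) :=
        Finset.sum_le_sum fun j _ => hj j
    _ = ∑ j, (M.filter fun s => j ∈ y s).card + B.card * M.card := by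
        rw [Finset.sum_add_distrib]
        simp
    _ ≤ _ := by
        gcongr

end Slots

/-! ### The bounds of the algorithm -/

section Algorithm

variable {J : Type*} [Fintype J]

/-- The schedule respects the bounds. -/
def Instance.Respects (I : Instance J) (S : Assignment I.procs J) (b : Bounds) : Prop :=
  ∀ t ∈ I.slots, b.lo t ≤ vol S t ∧ vol S t ≤ b.hi t

/-- The bounds before processor `k` is dealt with. -/
structure Instance.SweepInv (I : Instance J) (k : ℕ) (b : Bounds) : Prop where
  feasible : I.BoundsFeasible b
  hi : ∀ s, k ≤ b.hi s
  lo : ∀ s, b.lo s = 0 ∨ k < b.lo s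

/-- The bounds while processor `k` is dealt with, when slot `t` has been reached. -/
structure Instance.RoundInv (I : Instance J) (k t : ℕ) (b : Bounds) : Prop where
  feasible : I.BoundsFeasible b
  hi : ∀ s, k ≤ b.hi s + 1
  hi_of_le : ∀ s, t ≤ s → k ≤ b.hi s
  lo : ∀ s, b.lo s = 0 ∨ k ≤ b.lo s
  lo_of_le : ∀ s, t ≤ s → b.lo s = 0 ∨ k < b.lo s

variable {I : Instance J}

theorem Instance.SweepInv.roundInv {k : ℕ} {b : Bounds} (h : I.SweepInv k b) :
    I.RoundInv k 0 b where
  feasible := h.feasible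
  hi s := (h.hi s).trans (Nat.le_succ _)
  hi_of_le s _ := h.hi s
  lo s := (h.lo s).imp_right le_of_lt
  lo_of_le s _ := h.lo s

theorem Bounds.setIdle_self (b : Bounds) (k t : ℕ) : b.setIdle k t t = b := by
  cases b
  simp only [Bounds.setIdle, Bounds.mk.injEq, true_and]
  funext s
  exact if_neg (by omega)

theorem Bounds.setBusy_self (b : Bounds) (k t : ℕ) : b.setBusy k t t = b := by
  cases b
  simp only [Bounds.setBusy, Bounds.mk.injEq, and_true]
  funext s
  exact if_neg (by omega)

/-- One pass of the while-loop: an idle stretch `[t, t₁)` and a busy stretch `[t₁, t₂)`, neither of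
which can be extended. -/
theorem Instance.round_spec {k t : ℕ} {b : Bounds} (hb : I.BoundsFeasible b)
    (ht : t ≤ I.horizon) :
    ∃ t₁ t₂, t ≤ t₁ ∧ t₁ ≤ t₂ ∧ I.round k (t, b) = (t₂, (b.setIdle k t t₁).setBusy k t₁ t₂) ∧
      (t₁ ≤ I.horizon → ¬ I.BoundsFeasible (b.setIdle k t (t₁ + 1))) ∧
      (t₂ ≤ I.horizon → ¬ I.BoundsFeasible ((b.setIdle k t t₁).setBusy k t₁ (t₂ + 1))) := by
  obtain ⟨h1, h2, h3, h4⟩ := I.latest_spec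
    (fun t' => I.BoundsFeasible (b.setIdle k t t')) (t := t) (by omega)
    (by simpa [Bounds.setIdle_self] using hb)
  have e : I.keepIdle k (t, b) = (I.latest t (fun t' => I.BoundsFeasible (b.setIdle k t t')),
    b.setIdle k t (I.latest t (fun t' => I.BoundsFeasible (b.setIdle k t t')))) := rfl
  rw [round, if_pos ht, e]
  generalize I.latest t (fun t' => I.BoundsFeasible (b.setIdle k t t')) = t₁ at *
  generalize hb1 : b.setIdle k t t₁ = b₁ at *
  obtain ⟨g1, g2, g3, g4⟩ := I.latest_spec
    (fun t' => I.BoundsFeasible (b₁.setBusy k t₁ t')) (t := t₁) h2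
    (by simpa [Bounds.setBusy_self, hb1] using h3)
  refine ⟨t₁, _, h1, g1, by rw [hb1]; rfl, fun h hf => ?_, fun h hf => ?_⟩
  · have := h4 (t₁ + 1) (by omega) (by omega) hf
    omega
  · rw [hb1] at hf
    have := g4 _ (by omega) (g1.trans (Nat.le_succ _)) hf
    omega

theorem Instance.RoundInv.round {k t : ℕ} {b : Bounds} (hk : 1 ≤ k) (h : I.RoundInv k t b) :
    I.RoundInv k (I.round k (t, b)).1 (I.round k (t, b)).2 := by
  by_cases ht : t ≤ I.horizon
  · have hf := (I.lt_round hk b h.feasible ht).2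
    obtain ⟨t₁, t₂, h1, h2, e, -, -⟩ := I.round_spec (k := k) h.feasible ht
    rw [e] at hf ⊢
    refine ⟨hf, fun s => ?_, fun s hs => ?_, fun s => ?_, fun s hs => ?_⟩ <;>
      have a1 := h.hi s <;> have a2 := h.hi_of_le s <;> have a3 := h.lo s <;>
      have a4 := h.lo_of_le s <;> simp only [Bounds.setIdle, Bounds.setBusy] at * <;>
      split_ifs <;> omega
  · have hr : I.round k (t, b) = (t, b) := if_neg ht
    rw [hr]
    exact h

theorem Instance.RoundInv.respects_of_round {k t : ℕ} {b : Bounds} (h : I.RoundInv k t b)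
    {S : Assignment I.procs J} (hS : I.Respects S (I.round k (t, b)).2) : I.Respects S b := by
  by_cases ht : t ≤ I.horizon
  · obtain ⟨t₁, t₂, h1, h2, e, -, -⟩ := I.round_spec (k := k) h.feasible ht
    rw [e] at hS
    intro s hs
    have a := hS s hs
    have a2 := h.hi_of_le s
    simp only [Bounds.setIdle, Bounds.setBusy] at a
    split_ifs at a <;> omega
  · have hr : I.round k (t, b) = (t, b) := if_neg ht
    rw [hr] at hS
    exact hS

/-- The effect of dealing with processor `k` on the final schedule: work from the first slot of a
busy interval cannot be shifted to slots with few busy processors, and for `k = 1` work cannot be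
shifted to the slot right after a busy interval. -/
structure Instance.Stable (I : Instance J) (S : Assignment I.procs J) (k : ℕ) : Prop where
  of_start : ∀ b, b ≤ I.horizon → vol S b = k → (b = 0 ∨ vol S (b - 1) < k) →
    ∀ s, I.Reach (jobsAt S) b s → k ≤ vol S s + 1 ∧ (b ≤ s → k ≤ vol S s)
  of_end : k = 1 → ∀ c, 1 ≤ c → vol S c = 0 → 0 < vol S (c - 1) →
    ∀ b, c < b → b ≤ I.horizon → vol S b = 1 → ¬ I.Reach (jobsAt S) b c

/-- Used to find the pass of the while-loop that covers a given slot. -/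
theorem exists_le_lt_succ {f : ℕ → ℕ} {u : ℕ} (h0 : f 0 ≤ u) :
    ∀ {n : ℕ}, u < f n → ∃ i < n, f i ≤ u ∧ u < f (i + 1)
  | 0, h => absurd h (not_lt.2 h0)
  | n + 1, h => by
    by_cases hn : u < f n
    · obtain ⟨i, hi, h⟩ := exists_le_lt_succ h0 hn
      exact ⟨i, hi.trans (Nat.lt_succ_self n), h⟩
    · exact ⟨n, Nat.lt_succ_self n, not_lt.1 hn, h⟩

/-- The idle stretch of the pass ends exactly before `b`: the load `k` at `b` is too large for it,
and a smaller load before `b` is too small for the busy stretch. If the conclusion failed, shifting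
a unit from `b` to `s` would allow the idle stretch to include `b`. The lower bound at `b` is 0 at
this stage, since it is 0 or exceeds `k`. -/
theorem Instance.RoundInv.start_of_round {k t u b : ℕ} {β : Bounds} (hk : 1 ≤ k)
    (h : I.RoundInv k t β) (ht : t ≤ u) (hu : u < (I.round k (t, β)).1) (hub : u = b - 1)
    {S : Assignment I.procs J} (hSf : I.Feasible S) (hS : I.Respects S (I.round k (t, β)).2)
    (hb : b ≤ I.horizon) (hvb : vol S b = k) (hvu : b = 0 ∨ vol S (b - 1) < k) {s : ℕ}
    (hr : I.Reach (jobsAt S) b s) : k ≤ vol S s + 1 ∧ (b ≤ s → k ≤ vol S s) := by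
  have hS0 := h.respects_of_round hS
  have hth : t ≤ I.horizon := by omega
  obtain ⟨t₁, t₂, h1, h2, e, hidle, -⟩ := I.round_spec (k := k) h.feasible hth
  rw [e] at hS hu
  simp only at hu
  have hbt : b ≤ t₁ := by
    by_contra hlt
    have := (hS u (Instance.mem_slots.2 (by omega))).1
    simp only [Bounds.setBusy] at this
    rw [if_pos (by omega)] at this
    subst hub
    have := le_max_left k ((β.setIdle k t t₁).lo (b - 1))
    omega
  have hbt' : t₁ = b := by
    by_contra hne
    have := (hS b (Instance.mem_slots.2 hb)).2
    simp only [Bounds.setBusy, Bounds.setIdle] at this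
    rw [if_pos (by omega)] at this
    omega
  subst hbt'
  by_contra hcon
  have hsb : s ≠ t₁ := by
    rintro rfl
    omega
  obtain ⟨S', hS', hv⟩ := hSf.exchange hb hr (by have := vol_le_procs S t₁; omega)
  refine hidle hb ⟨S', hS', fun w hw => ?_⟩
  have a1 := hv w
  have a2 := hS w hw
  have a3 := hS0 w hw
  have a4 := h.lo_of_le w
  have a5 := h.hi_of_le w
  have a6 := h.hi w
  simp only [Bounds.setIdle, Bounds.setBusy] at a2 ⊢
  by_cases e1 : w = t₁
  · subst e1
    rw [if_pos rfl, if_neg hsb.symm] at a1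
    rw [if_pos (by omega)]
    omega
  · rw [if_neg e1] at a1
    -- Before `b` the increased load must not exceed `k - 1`; after `b` it may be `k`. This is why
    -- the two halves of the conclusion differ by one.
    by_cases e2 : w = s
    · subst e2
      rw [if_pos rfl] at a1
      split_ifs at a2 ⊢ <;> omega
    · rw [if_neg e2] at a1
      split_ifs at a2 ⊢ <;> omega

/-- The busy stretch of the pass ends exactly before `c`, and moving a unit from `b` to `c` would
prolong it. Emptying `b` is harmless: `b` lies beyond the stretch and, having load 1, still has
lower bound 0. -/
theorem Instance.RoundInv.end_of_round {t u b c : ℕ} {β : Bounds}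
    (h : I.RoundInv 1 t β) (ht : t ≤ u) (hu : u < (I.round 1 (t, β)).1) (huc : u = c - 1)
    {S : Assignment I.procs J} (hSf : I.Feasible S) (hS : I.Respects S (I.round 1 (t, β)).2)
    (hc : 1 ≤ c) (hvc : vol S c = 0) (hvu : 0 < vol S (c - 1)) (hcb : c < b)
    (hb : b ≤ I.horizon) (hvb : vol S b = 1) : ¬ I.Reach (jobsAt S) b c := by
  intro hr
  have hS0 := h.respects_of_round hS
  obtain ⟨t₁, t₂, h1, h2, e, -, hbusy⟩ :=
    I.round_spec (k := 1) (t := t) h.feasible (by omega)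
  rw [e] at hS hu
  simp only at hu
  have hut : t₁ ≤ u := by
    by_contra hlt
    have := (hS u (Instance.mem_slots.2 (by omega))).2
    simp only [Bounds.setBusy, Bounds.setIdle] at this
    rw [if_pos (by omega), huc] at this
    omega
  have hct : t₂ = c := by
    by_contra hne
    have := (hS c (Instance.mem_slots.2 (by omega))).1
    simp only [Bounds.setBusy] at this
    rw [if_pos (by omega)] at this
    have := le_max_left 1 ((β.setIdle 1 t t₁).lo c)
    omega
  subst hct
  obtain ⟨S', hS', hv⟩ := hSf.exchange hb hr (by have := vol_le_procs S b; omega)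
  refine hbusy (by omega) ⟨S', hS', fun w hw => ?_⟩
  have a1 := hv w
  have a2 := hS w hw
  have a3 := hS0 w hw
  have a4 := h.lo_of_le w
  have a5 := h.hi_of_le w
  simp only [Bounds.setIdle, Bounds.setBusy] at a2 ⊢
  by_cases e1 : w = b
  · subst e1
    rw [if_pos rfl, if_neg (by omega)] at a1
    rw [if_neg (by omega)] at a2 ⊢
    split_ifs at a2 ⊢ <;> omega
  · rw [if_neg e1] at a1
    by_cases e2 : w = t₂
    · subst e2
      rw [if_pos rfl] at a1
      rw [if_neg (by omega)] at a2
      rw [if_pos (by omega)]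
      split_ifs at a2 ⊢ <;> omega
    · rw [if_neg e2] at a1
      split_ifs at a2 ⊢ <;> omega

theorem Instance.SweepInv.roundInv_iterate {k : ℕ} {b : Bounds} (hk : 1 ≤ k) (h : I.SweepInv k b)
    (i : ℕ) : I.RoundInv k ((I.round k)^[i] (0, b)).1 ((I.round k)^[i] (0, b)).2 := by
  induction i with
  | zero => exact h.roundInv
  | succ i ih =>
    rw [Function.iterate_succ_apply']
    exact ih.round hk

theorem Instance.SweepInv.respects_iterate {k : ℕ} {b : Bounds} (hk : 1 ≤ k) (h : I.SweepInv k b)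
    {S : Assignment I.procs J} {i n : ℕ} (hin : i ≤ n)
    (hS : I.Respects S ((I.round k)^[n] (0, b)).2) :
    I.Respects S ((I.round k)^[i] (0, b)).2 := by
  induction n, hin using Nat.le_induction with
  | base => exact hS
  | succ n _ ih =>
    rw [Function.iterate_succ_apply'] at hS
    exact ih ((h.roundInv_iterate hk n).respects_of_round hS)

theorem Instance.SweepInv.sweep {k : ℕ} {b : Bounds} (h : I.SweepInv (k + 1) b) :
    I.SweepInv k (I.sweep (k + 1) b) := by
  have := h.roundInv_iterate (Nat.le_add_left 1 k) (I.horizon + 1)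
  exact ⟨this.feasible, fun s => Nat.le_of_succ_le_succ (this.hi s), fun s => this.lo s⟩

/-- Passes only tighten the bounds, so the schedule respects the bounds after every pass; the pass
covering the preceding slot decides. -/
theorem Instance.SweepInv.stable {k : ℕ} {b : Bounds} (hk : 1 ≤ k) (h : I.SweepInv k b)
    {S : Assignment I.procs J} (hSf : I.Feasible S) (hS : I.Respects S (I.sweep k b)) :
    I.Stable S k := by
  have hend := I.horizon_lt_iterate hk b h.feasible
  have hround : ∀ u ≤ I.horizon, ∃ i, ((I.round k)^[i] (0, b)).1 ≤ u ∧
      u < (I.round k ((I.round k)^[i] (0, b))).1 ∧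
      I.Respects S (I.round k ((I.round k)^[i] (0, b))).2 := by
    intro u hu
    obtain ⟨i, hi, h1, h2⟩ := exists_le_lt_succ (f := fun i => ((I.round k)^[i] (0, b)).1)
      (u := u) (Nat.zero_le u) (hu.trans_lt hend)
    refine ⟨i, h1, ?_, ?_⟩
    · rw [← Function.iterate_succ_apply' (I.round k)]
      exact h2
    · rw [← Function.iterate_succ_apply' (I.round k)]
      exact h.respects_iterate hk hi hS
  constructor
  · intro c hc hvc hvu s hr
    obtain ⟨i, h1, h2, h3⟩ := hround (c - 1) (by omega)
    exact (h.roundInv_iterate hk i).start_of_round hk h1 h2 rfl hSf h3 hc hvc hvu hr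
  · rintro rfl c hc hvc hvu c' hcc hc' hv'
    obtain ⟨i, h1, h2, h3⟩ := hround (c - 1) (by omega)
    exact (h.roundInv_iterate hk i).end_of_round h1 h2 rfl hSf h3 hc hvc hvu hcc hc' hv'

theorem Instance.SweepInv.sweepDown {k : ℕ} : ∀ {b : Bounds}, I.SweepInv k b →
    I.BoundsFeasible (I.sweepDown k b) ∧ ∀ S : Assignment I.procs J, I.Feasible S →
      I.Respects S (I.sweepDown k b) → I.Respects S b ∧ ∀ i, 1 ≤ i → i ≤ k → I.Stable S i := by
  induction k with
  | zero =>
    intro b h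
    exact ⟨h.feasible, fun S _ hS => ⟨hS, fun i _ _ => by omega⟩⟩
  | succ k ih =>
    intro b h
    obtain ⟨h1, h2⟩ := ih h.sweep
    refine ⟨h1, fun S hSf hS => ?_⟩
    obtain ⟨h3, h4⟩ := h2 S hSf hS
    refine ⟨h.respects_iterate (i := 0) (Nat.le_add_left 1 k) (Nat.zero_le _) h3, fun i h5 h6 => ?_⟩
    rcases Nat.lt_or_ge i (k + 1) with h7 | h7
    · exact h4 i h5 (by omega)
    · obtain rfl : i = k + 1 := by omega
      exact h.stable h5 hSf h3

theorem Instance.Solvable.sweepInv (hI : I.Solvable) :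
    I.SweepInv I.procs { lo := fun _ => 0, hi := fun _ => I.procs } := by
  obtain ⟨S, hS⟩ := hI
  exact ⟨⟨S, hS, fun t _ => ⟨Nat.zero_le _, vol_le_procs S t⟩⟩, fun _ => le_rfl,
    fun _ => Or.inl rfl⟩

theorem Instance.Solvable.exists_pltr (hI : I.Solvable) :
    ∃ S : Assignment I.procs J, I.IsPLTRSchedule S := by
  obtain ⟨S, hS, hb⟩ := hI.sweepInv.sweepDown.1
  obtain ⟨S', h1, h2, h3⟩ := hS.exists_stair
  exact ⟨S', h1, fun t ht => by rw [h3]; exact hb t ht, h2⟩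

theorem Instance.IsPLTRSchedule.stable {S : Assignment I.procs J} (hS : I.IsPLTRSchedule S)
    {k : ℕ} (h1 : 1 ≤ k) (hk : k ≤ I.procs) : I.Stable S k :=
  ((Instance.Solvable.sweepInv ⟨S, hS.1⟩).sweepDown.2 S hS.1 hS.2.1).2 k h1 hk

end Algorithm

/-! ### Comparing the schedule of the algorithm with another schedule -/

section Compare

theorem exists_first_gt {v : ℕ → ℕ} {k t b : ℕ} (htb : t < b) (ht : v t ≤ k) (hb : k < v b) :
    ∃ b', t < b' ∧ b' ≤ b ∧ k < v b' ∧ v (b' - 1) ≤ k := by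
  induction b, htb using Nat.le_induction with
  | base => exact ⟨t + 1, by omega, le_rfl, hb, ht⟩
  | succ b hlt ih =>
    by_cases h : k < v b
    · obtain ⟨b', h1, h2, h3⟩ := ih h
      exact ⟨b', h1, by omega, h3⟩
    · exact ⟨b + 1, by omega, le_rfl, hb, by simpa using h⟩

theorem exists_first_gt_or_zero {v : ℕ → ℕ} {k b : ℕ} (hb : k < v b) :
    ∃ b' ≤ b, k < v b' ∧ (b' = 0 ∨ v (b' - 1) ≤ k) := by
  by_cases h : v 0 ≤ k
  · obtain ⟨b', -, h2, h3, h4⟩ := exists_first_gt (v := v) (t := 0) (b := b)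
      (Nat.pos_of_ne_zero fun h0 => by subst h0; omega) h hb
    exact ⟨b', h2, h3, Or.inr h4⟩
  · exact ⟨0, Nat.zero_le b, not_le.1 h, Or.inl rfl⟩

variable {J : Type*} [Fintype J] {I : Instance J} {S S' : Assignment I.procs J}

theorem Instance.IsPLTRSchedule.vol_le_of_reach (hS : I.IsPLTRSchedule S) {b : ℕ}
    (hb : b ≤ I.horizon) (hvb : b = 0 ∨ vol S (b - 1) < vol S b) {s : ℕ}
    (hr : I.Reach (jobsAt S) b s) : vol S b ≤ vol S s + 1 ∧ (b ≤ s → vol S b ≤ vol S s) := by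
  rcases Nat.eq_zero_or_pos (vol S b) with h0 | h0
  · rw [h0]
    omega
  · exact (hS.stable h0 (vol_le_procs S b)).of_start b hb rfl hvb s hr

/-- `C` is an unreachable boundary of `W`. On the slots of `W` reachable from `b` the load is at
least `vol S b - 1`, and it is larger at `b` itself, so failure everywhere on `W` would contradict
the averaged comparison `Instance.SlotFeasible.sum_card_le`. -/
theorem Instance.IsPLTRSchedule.exists_vol_ge (hS : I.IsPLTRSchedule S) (hS' : I.Feasible S')
    {b : ℕ} (hb : b ≤ I.horizon) (hvb : b = 0 ∨ vol S (b - 1) < vol S b) (C W : Finset ℕ)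
    (hbW : b ∈ W) (hC : ∀ c ∈ C, ¬ I.Reach (jobsAt S) b c)
    (hW : ∀ u ∈ W, ∀ w ∈ I.slots, w ∉ W → ∃ c ∈ C, u ≤ c ∧ c ≤ w ∨ w ≤ c ∧ c ≤ u) :
    ∃ s ∈ W, s ≤ I.horizon ∧ vol S b ≤ vol S' s + ∑ c ∈ C, vol S c := by
  classical
  by_contra! hcon
  let Q := I.slots.filter fun s => I.Reach (jobsAt S) b s
  have hQ : ∀ s, s ∈ Q ↔ I.Reach (jobsAt S) b s := fun s => by
    simp only [Q, Finset.mem_filter, Instance.mem_slots, and_iff_right_iff_imp]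
    exact fun h => h.le_horizon hb
  have h := hS.1.slotFeasible.sum_card_le hS'.slotFeasible Q C W (Q ∩ W)
    (fun t => Finset.mem_inter)
    (Finset.inter_subset_left.trans (Finset.filter_subset _ _))
    (fun u hu w hw => (hQ w).2 (((hQ u).1 hu).tail hw))
    (fun c hc hcQ => hC c hc ((hQ c).1 hcQ)) hW
  simp only [← hS.1.vol_eq, ← hS'.vol_eq] at h
  have hbM : b ∈ Q ∩ W := Finset.mem_inter.2 ⟨(hQ b).2 .refl, hbW⟩
  have hlt : ∑ s ∈ Q ∩ W, (vol S' s + ∑ c ∈ C, vol S c) < ∑ s ∈ Q ∩ W, vol S s := by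
    refine Finset.sum_lt_sum (fun s hs => ?_) ⟨b, hbM, hcon b hbW hb⟩
    obtain ⟨h1, h2⟩ := Finset.mem_inter.1 hs
    have h3 := hcon s h2 (((hQ s).1 h1).le_horizon hb)
    have h4 := (hS.vol_le_of_reach hb hvb ((hQ s).1 h1)).1
    omega
  rw [Finset.sum_add_distrib, Finset.sum_const, smul_eq_mul, mul_comm] at hlt
  omega

theorem Instance.IsPLTRSchedule.not_reach_of_lt (hS : I.IsPLTRSchedule S) {b c k : ℕ}
    (hb : b ≤ I.horizon) (hvb : b = 0 ∨ vol S (b - 1) < vol S b) (hk : k < vol S b)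
    (hc : vol S c < k) : ¬ I.Reach (jobsAt S) b c := by
  intro hr
  have := (hS.vol_le_of_reach hb hvb hr).1
  omega

theorem Instance.IsPLTRSchedule.not_reach_of_le (hS : I.IsPLTRSchedule S) {b c k : ℕ}
    (hb : b ≤ I.horizon) (hvb : b = 0 ∨ vol S (b - 1) < vol S b) (hk : k < vol S b)
    (hbc : b ≤ c) (hc : vol S c ≤ k) : ¬ I.Reach (jobsAt S) b c := by
  intro hr
  have := (hS.vol_le_of_reach hb hvb hr).2 hbc
  omega

/-- From a start of load at least 2, load 0 is out of reach anyway. From load 1, `of_start` permits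
an earlier empty slot, and only the maximality of busy stretches excludes it. -/
theorem Instance.IsPLTRSchedule.not_reach_end (hS : I.IsPLTRSchedule S) {b c : ℕ}
    (hb : b ≤ I.horizon) (hvb : b = 0 ∨ vol S (b - 1) < vol S b) (hk : 0 < vol S b)
    (hc : 1 ≤ c) (hvc : vol S c = 0) (hvc' : 0 < vol S (c - 1)) (hcb : c < b) :
    ¬ I.Reach (jobsAt S) b c := by
  rcases Nat.lt_or_ge 1 (vol S b) with h | h
  · exact hS.not_reach_of_lt hb hvb h (by omega)
  · exact (hS.stable le_rfl (hk.trans_le (vol_le_procs S b))).of_end rfl c hc hvc hvc' b hcb hb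
      (by omega)

/-- The volumes `v` of a schedule of the algorithm in comparison with the volumes `V` of an arbitrary
schedule, in slots `0, …, d`. -/
structure Dominates (d : ℕ) (v V : ℕ → ℕ) : Prop where
  between : ∀ k t b t', t < b → b < t' → t' ≤ d → v t < k → v t' ≤ k → k < v b →
    ∃ s, t < s ∧ s < t' ∧ k + 1 ≤ V s + v t + v t'
  after : ∀ k t b, t < b → b ≤ d → v t < k → k < v b → ∃ s, t < s ∧ s ≤ d ∧ k + 1 ≤ V s + v t
  before : ∀ k b t, b < t → t ≤ d → v t ≤ k → k < v b → ∃ s, s < t ∧ k + 1 ≤ V s + v t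
  somewhere : ∀ k b, b ≤ d → k < v b → ∃ s ≤ d, k + 1 ≤ V s
  between_end : ∀ c b t', 1 ≤ c → v c = 0 → 0 < v (c - 1) → c < b → b < t' → t' ≤ d → v t' = 0 →
    0 < v b → ∃ s, c < s ∧ s < t' ∧ 1 ≤ V s
  after_end : ∀ c b, 1 ≤ c → v c = 0 → 0 < v (c - 1) → c < b → b ≤ d → 0 < v b →
    ∃ s, c < s ∧ s ≤ d ∧ 1 ≤ V s

/-- Allows passing from busy processors of the competitor to those that are on. -/
theorem Dominates.mono {d : ℕ} {v V n : ℕ → ℕ} (h : Dominates d v V) (hn : ∀ t, V t ≤ n t) :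
    Dominates d v n where
  between k t b t' h1 h2 h3 h4 h5 h6 := by
    obtain ⟨s, a1, a2, a3⟩ := h.between k t b t' h1 h2 h3 h4 h5 h6
    exact ⟨s, a1, a2, by have := hn s; omega⟩
  after k t b h1 h2 h3 h4 := by
    obtain ⟨s, a1, a2, a3⟩ := h.after k t b h1 h2 h3 h4
    exact ⟨s, a1, a2, by have := hn s; omega⟩
  before k b t h1 h2 h3 h4 := by
    obtain ⟨s, a1, a3⟩ := h.before k b t h1 h2 h3 h4
    exact ⟨s, a1, by have := hn s; omega⟩
  somewhere k b h1 h2 := by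
    obtain ⟨s, a1, a3⟩ := h.somewhere k b h1 h2
    exact ⟨s, a1, a3.trans (hn s)⟩
  between_end c b t' h1 h2 h3 h4 h5 h6 h7 h8 := by
    obtain ⟨s, a1, a2, a3⟩ := h.between_end c b t' h1 h2 h3 h4 h5 h6 h7 h8
    exact ⟨s, a1, a2, a3.trans (hn s)⟩
  after_end c b h1 h2 h3 h4 h5 h6 := by
    obtain ⟨s, a1, a2, a3⟩ := h.after_end c b h1 h2 h3 h4 h5 h6
    exact ⟨s, a1, a2, a3.trans (hn s)⟩

/-- In each clause `exists_vol_ge` is applied at the first rise above the level; `W` is the range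
delimited by the given low slots, and `C` consists of these slots. -/
theorem Instance.IsPLTRSchedule.dominates (hS : I.IsPLTRSchedule S) (hS' : I.Feasible S') :
    Dominates I.horizon (vol S) (vol S') where
  between k t b t' htb hbt' ht' hvt hvt' hvb := by
    obtain ⟨b', h1, h2, h3, h4⟩ := exists_first_gt htb hvt.le hvb
    have hst : b' = 0 ∨ vol S (b' - 1) < vol S b' := Or.inr (by omega)
    have hb' : b' ≤ I.horizon := by omega
    obtain ⟨s, hs, -, h⟩ := hS.exists_vol_ge hS' hb' hst {t, t'} (Finset.Ioo t t')
      (Finset.mem_Ioo.2 ⟨h1, by omega⟩) (fun c hc => by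
        rcases Finset.mem_insert.1 hc with rfl | hc
        · exact hS.not_reach_of_lt hb' hst h3 hvt
        · rw [Finset.mem_singleton.1 hc]
          exact hS.not_reach_of_le hb' hst h3 (by omega) hvt') (fun u hu w _ hw => by
        rw [Finset.mem_Ioo] at hu hw
        rcases le_or_gt w t with h | h
        · exact ⟨t, by simp, by omega⟩
        · exact ⟨t', by simp, by omega⟩)
    rw [Finset.sum_pair (by omega)] at h
    rw [Finset.mem_Ioo] at hs
    exact ⟨s, hs.1, hs.2, by omega⟩
  after k t b htb hb hvt hvb := by
    obtain ⟨b', h1, h2, h3, h4⟩ := exists_first_gt htb hvt.le hvb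
    have hst : b' = 0 ∨ vol S (b' - 1) < vol S b' := Or.inr (by omega)
    have hb' : b' ≤ I.horizon := by omega
    obtain ⟨s, hs, hs', h⟩ := hS.exists_vol_ge hS' hb' hst {t} (Finset.Ioc t I.horizon)
      (Finset.mem_Ioc.2 ⟨h1, hb'⟩) (fun c hc => by
        rw [Finset.mem_singleton.1 hc]
        exact hS.not_reach_of_lt hb' hst h3 hvt) (fun u hu w hwd hw => by
        rw [Finset.mem_Ioc] at hu hw
        rw [Instance.mem_slots] at hwd
        exact ⟨t, by simp, by omega⟩)
    rw [Finset.sum_singleton] at h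
    exact ⟨s, (Finset.mem_Ioc.1 hs).1, hs', by omega⟩
  before k b t hbt ht hvt hvb := by
    obtain ⟨b', h2, h3, h4⟩ := exists_first_gt_or_zero hvb
    have hst : b' = 0 ∨ vol S (b' - 1) < vol S b' := h4.imp_right fun h => by omega
    have hb' : b' ≤ I.horizon := by omega
    obtain ⟨s, hs, hs', h⟩ := hS.exists_vol_ge hS' hb' hst {t} (Finset.range t)
      (Finset.mem_range.2 (by omega)) (fun c hc => by
        rw [Finset.mem_singleton.1 hc]
        exact hS.not_reach_of_le hb' hst h3 (by omega) hvt) (fun u hu w _ hw => by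
        rw [Finset.mem_range] at hu hw
        exact ⟨t, by simp, by omega⟩)
    rw [Finset.sum_singleton] at h
    exact ⟨s, Finset.mem_range.1 hs, by omega⟩
  somewhere k b hb hvb := by
    obtain ⟨b', h2, h3, h4⟩ := exists_first_gt_or_zero hvb
    have hst : b' = 0 ∨ vol S (b' - 1) < vol S b' := h4.imp_right fun h => by omega
    have hb' : b' ≤ I.horizon := by omega
    obtain ⟨s, hs, hs', h⟩ := hS.exists_vol_ge hS' hb' hst ∅ I.slots
      (Instance.mem_slots.2 hb') (by simp) (fun u _ w hw hw' => absurd hw hw')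
    rw [Finset.sum_empty] at h
    exact ⟨s, hs', by omega⟩
  between_end c b t' hc hvc hvc' hcb hbt' ht' hvt' hvb := by
    obtain ⟨b', h1, h2, h3, h4⟩ := exists_first_gt hcb hvc.le hvb
    have hst : b' = 0 ∨ vol S (b' - 1) < vol S b' := Or.inr (by omega)
    have hb' : b' ≤ I.horizon := by omega
    obtain ⟨s, hs, -, h⟩ := hS.exists_vol_ge hS' hb' hst {c, t'} (Finset.Ioo c t')
      (Finset.mem_Ioo.2 ⟨h1, by omega⟩) (fun x hx => by
        rcases Finset.mem_insert.1 hx with rfl | hx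
        · exact hS.not_reach_end hb' hst h3 hc hvc hvc' h1
        · rw [Finset.mem_singleton.1 hx]
          exact hS.not_reach_of_le hb' hst h3 (by omega) hvt'.le) (fun u hu w _ hw => by
        rw [Finset.mem_Ioo] at hu hw
        rcases le_or_gt w c with h | h
        · exact ⟨c, by simp, by omega⟩
        · exact ⟨t', by simp, by omega⟩)
    rw [Finset.sum_pair (by omega)] at h
    rw [Finset.mem_Ioo] at hs
    exact ⟨s, hs.1, hs.2, by omega⟩
  after_end c b hc hvc hvc' hcb hb hvb := by
    obtain ⟨b', h1, h2, h3, h4⟩ := exists_first_gt hcb hvc.le hvb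
    have hst : b' = 0 ∨ vol S (b' - 1) < vol S b' := Or.inr (by omega)
    have hb' : b' ≤ I.horizon := by omega
    obtain ⟨s, hs, hs', h⟩ := hS.exists_vol_ge hS' hb' hst {c} (Finset.Ioc c I.horizon)
      (Finset.mem_Ioc.2 ⟨h1, hb'⟩) (fun x hx => by
        rw [Finset.mem_singleton.1 hx]
        exact hS.not_reach_end hb' hst h3 hc hvc hvc' h1) (fun u hu w hwd hw => by
        rw [Finset.mem_Ioc] at hu hw
        rw [Instance.mem_slots] at hwd
        exact ⟨c, by simp, by omega⟩)
    rw [Finset.sum_singleton] at h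
    exact ⟨s, (Finset.mem_Ioc.1 hs).1, hs', by omega⟩

end Compare

/-! ### Maximal intervals -/

section Intervals

variable {d : ℕ} {A : ℕ → Prop}

theorem mem_maxIntervals {N : ℕ × ℕ} : N ∈ maxIntervals d A ↔
    N.1 ≤ N.2 ∧ N.2 ≤ d ∧ (∀ t, N.1 ≤ t → t ≤ N.2 → A t) ∧ (N.1 = 0 ∨ ¬ A (N.1 - 1)) ∧
      (N.2 = d ∨ ¬ A (N.2 + 1)) := by
  obtain ⟨a, b⟩ := N
  simp only [maxIntervals, Finset.mem_filter, Finset.mem_product, Finset.mem_range, Finset.mem_Icc]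
  constructor
  · rintro ⟨⟨h1, h2⟩, h3, h4, h5⟩
    refine ⟨h3, by omega, fun t h h' => h4 t ⟨h, h'⟩, ?_, ?_⟩
    · by_contra! h
      have := h5 (a - 1) b (by omega) le_rfl (by omega) fun t ht => by
        rcases Nat.lt_or_ge t a with hta | hta
        · obtain rfl : t = a - 1 := by omega
          exact h.2
        · exact h4 t ⟨hta, ht.2⟩
      omega
    · by_contra! h
      have := h5 a (b + 1) le_rfl (by omega) (by omega) fun t ht => by
        rcases Nat.lt_or_ge b t with hta | hta
        · obtain rfl : t = b + 1 := by omega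
          exact h.2
        · exact h4 t ⟨ht.1, hta⟩
      omega
  · rintro ⟨h1, h2, h3, h4, h5⟩
    refine ⟨⟨by omega, by omega⟩, h1, fun t ht => h3 t ht.1 ht.2, fun a' b' ha hb hd h => ?_⟩
    constructor
    · by_contra hne
      rcases h4 with h4 | h4
      · omega
      · exact h4 (h _ ⟨by omega, by omega⟩)
    · by_contra hne
      rcases h5 with h5 | h5
      · omega
      · exact h5 (h _ ⟨by omega, by omega⟩)

theorem exists_mem_maxIntervals {t : ℕ} (ht : t ≤ d) (hA : A t) :
    ∃ N ∈ maxIntervals d A, N.1 ≤ t ∧ t ≤ N.2 := by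
  classical
  have hl : ∃ a, a ≤ t ∧ ∀ s, a ≤ s → s ≤ t → A s :=
    ⟨t, le_rfl, fun s h1 h2 => by rwa [le_antisymm h2 h1]⟩
  have hr : ∃ l, d ≤ t + l ∨ ¬ A (t + l + 1) := ⟨d, Or.inl (Nat.le_add_left d t)⟩
  obtain ⟨h1, h2⟩ := Nat.find_spec hl
  have h3 := Nat.find_spec hr
  have h4 : ∀ l ≤ Nat.find hr, t + l ≤ d ∧ A (t + l) := by
    intro l
    induction l with
    | zero => exact fun _ => ⟨ht, hA⟩
    | succ l _ =>
      intro hl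
      have := Nat.find_min hr (m := l) (by omega)
      push Not at this
      exact ⟨by omega, this.2⟩
  refine ⟨(Nat.find hl, t + Nat.find hr), mem_maxIntervals.2
    ⟨by dsimp only; omega, (h4 _ le_rfl).1, fun s hs hs' => ?_, ?_, ?_⟩, h1, Nat.le_add_right _ _⟩
  · rcases Nat.lt_or_ge t s with h | h
    · obtain ⟨l, rfl⟩ := Nat.exists_eq_add_of_lt h
      exact (h4 (l + 1) (by dsimp only at hs'; omega)).2
    · exact h2 s hs h
  · by_contra! h
    dsimp only at h
    refine Nat.find_min hl (m := Nat.find hl - 1) (by omega) ⟨by omega, fun s hs hs' => ?_⟩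
    rcases Nat.lt_or_ge s (Nat.find hl) with h' | h'
    · obtain rfl : s = Nat.find hl - 1 := by omega
      exact h.2
    · exact h2 s h' hs'
  · rcases h3 with h3 | h3
    · exact Or.inl (le_antisymm (h4 _ le_rfl).1 h3)
    · exact Or.inr h3

/-- Distinct maximal intervals are separated by a slot outside `A`. -/
theorem maxIntervals_sep {N N' : ℕ × ℕ} (hN : N ∈ maxIntervals d A) (hN' : N' ∈ maxIntervals d A)
    (hne : N ≠ N') {t t' : ℕ} (h1 : N.1 ≤ t) (_ : t ≤ N.2) (_ : N'.1 ≤ t') (h2' : t' ≤ N'.2)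
    (htt : t ≤ t') : N.2 + 1 < N'.1 ∧ ¬ A (N.2 + 1) ∧ ¬ A (N'.1 - 1) := by
  rw [mem_maxIntervals] at hN hN'
  obtain ⟨a1, a2, a3, a4, a5⟩ := hN
  obtain ⟨b1, b2, b3, b4, b5⟩ := hN'
  by_cases h : N.2 + 1 < N'.1
  · exact ⟨h, a5.resolve_left (by omega), b4.resolve_left (by omega)⟩
  exfalso
  apply hne
  rcases Nat.lt_or_ge N.2 N'.1 with hlt | hge
  · exact absurd (b3 _ (by omega) (by omega)) (a5.resolve_left (by omega))
  have e2 : N.2 = N'.2 := by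
    rcases lt_trichotomy N.2 N'.2 with h | h | h
    · exact absurd (b3 _ (by omega) (by omega)) (a5.resolve_left (by omega))
    · exact h
    · exact absurd (a3 _ (by omega) (by omega)) (b5.resolve_left (by omega))
  have e1 : N.1 = N'.1 := by
    rcases lt_trichotomy N.1 N'.1 with h | h | h
    · exact absurd (a3 _ (by omega) (by omega)) (b4.resolve_left (by omega))
    · exact h
    · exact absurd (b3 _ (by omega) (by omega)) (a4.resolve_left (by omega))
  exact Prod.ext e1 e2

theorem maxIntervals_eq {N N' : ℕ × ℕ} (hN : N ∈ maxIntervals d A) (hN' : N' ∈ maxIntervals d A)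
    {t : ℕ} (h1 : N.1 ≤ t) (h2 : t ≤ N.2) (h1' : N'.1 ≤ t) (h2' : t ≤ N'.2) : N = N' := by
  by_contra hne
  have := (maxIntervals_sep hN hN' hne h1 h2 h1' h2' le_rfl).1
  omega

theorem sum_maxIntervals [DecidablePred A] {M : Type*} [AddCommMonoid M] (f : ℕ → M) :
    ∑ N ∈ maxIntervals d A, ∑ t ∈ Finset.Icc N.1 N.2, f t =
      ∑ t ∈ (Finset.range (d + 1)).filter A, f t := by
  rw [← Finset.sum_biUnion]
  · congr 1
    ext t
    simp only [Finset.mem_biUnion, Finset.mem_Icc, Finset.mem_filter, Finset.mem_range]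
    constructor
    · rintro ⟨N, hN, h1, h2⟩
      rw [mem_maxIntervals] at hN
      exact ⟨by omega, hN.2.2.1 t h1 h2⟩
    · rintro ⟨h1, h2⟩
      exact exists_mem_maxIntervals (by omega) h2
  · intro N hN N' hN' hne
    rw [Function.onFun, Finset.disjoint_left]
    intro t ht ht'
    rw [Finset.mem_Icc] at ht ht'
    exact hne (maxIntervals_eq hN hN' ht.1 ht.2 ht'.1 ht'.2)

theorem len_eq_card (N : ℕ × ℕ) : len N = (Finset.Icc N.1 N.2).card := by
  simp [len]

theorem sum_len_maxIntervals [DecidablePred A] :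
    ∑ N ∈ maxIntervals d A, len N = ((Finset.range (d + 1)).filter A).card := by
  simp only [len_eq_card, Finset.card_eq_sum_ones]
  exact sum_maxIntervals _

open Classical in
theorem card_starts_le :
    ((Finset.range (d + 1)).filter fun t => A t ∧ (t = 0 ∨ ¬ A (t - 1))).card ≤
      (maxIntervals d A).card := by
  refine (Finset.card_le_card ?_).trans (Finset.card_image_le (f := Prod.fst))
  intro t ht
  simp only [Finset.mem_filter, Finset.mem_range] at ht
  obtain ⟨N, hN, h1, h2⟩ := exists_mem_maxIntervals (d := d) (by omega) ht.2.1
  refine Finset.mem_image.2 ⟨N, hN, ?_⟩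
  by_contra hne
  rw [mem_maxIntervals] at hN
  have := ht.2.2.resolve_left (by omega)
  exact this (hN.2.2.1 _ (by omega) (by omega))

/-- The slots where `A` fails or that lie in a maximal `A`-interval with property `G`. -/
def fill (d : ℕ) (A : ℕ → Prop) (G : ℕ × ℕ → Prop) (t : ℕ) : Prop :=
  ¬ A t ∨ ∃ N ∈ maxIntervals d A, t ∈ Finset.Icc N.1 N.2 ∧ G N

open Classical in
theorem card_fill_le [DecidablePred A] (G : ℕ × ℕ → Prop) :
    ((Finset.range (d + 1)).filter (fill d A G)).card ≤
      ((Finset.range (d + 1)).filter fun t => ¬ A t).card +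
        ∑ N ∈ (maxIntervals d A).filter G, len N := by
  have hsub : (Finset.range (d + 1)).filter (fill d A G) ⊆
      ((Finset.range (d + 1)).filter fun t => ¬ A t) ∪
        ((maxIntervals d A).filter G).biUnion fun N => Finset.Icc N.1 N.2 := by
    intro t ht
    obtain ⟨h1, h2 | ⟨N, hN, ht', hG⟩⟩ := Finset.mem_filter.1 ht
    · exact Finset.mem_union_left _ (Finset.mem_filter.2 ⟨h1, h2⟩)
    · exact Finset.mem_union_right _
        (Finset.mem_biUnion.2 ⟨N, Finset.mem_filter.2 ⟨hN, hG⟩, ht'⟩)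
  refine (Finset.card_le_card hsub).trans ((Finset.card_union_le _ _).trans ?_)
  gcongr
  simp only [len_eq_card]
  exact Finset.card_biUnion_le

theorem not_fill_iff {G : ℕ × ℕ → Prop} {N : ℕ × ℕ} (hN : N ∈ maxIntervals d A) {t : ℕ}
    (h1 : N.1 ≤ t) (h2 : t ≤ N.2) : ¬ fill d A G t ↔ ¬ G N := by
  rw [fill, not_iff_not]
  constructor
  · rintro (h | ⟨N', hN', ht, hG⟩)
    · exact absurd ((mem_maxIntervals.1 hN).2.2.1 t h1 h2) h
    · rw [Finset.mem_Icc] at ht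
      rwa [maxIntervals_eq hN hN' h1 h2 ht.1 ht.2]
  · exact fun h => Or.inr ⟨N, hN, Finset.mem_Icc.2 ⟨h1, h2⟩, h⟩

theorem exists_of_not_fill {G : ℕ × ℕ → Prop} {t : ℕ} (ht : t ≤ d) (h : ¬ fill d A G t) :
    ∃ N ∈ maxIntervals d A, N.1 ≤ t ∧ t ≤ N.2 ∧ ¬ G N := by
  have hA : A t := by
    by_contra hA
    exact h (Or.inl hA)
  obtain ⟨N, hN, h1, h2⟩ := exists_mem_maxIntervals ht hA
  exact ⟨N, hN, h1, h2, (not_fill_iff hN h1 h2).1 h⟩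

open Classical in
theorem card_fill_ends_le (G : ℕ × ℕ → Prop) :
    ((Finset.range (d + 1)).filter fun t =>
      ¬ fill d A G t ∧ (t = d ∨ fill d A G (t + 1))).card ≤
      ((maxIntervals d A).filter fun N => ¬ G N).card := by
  refine (Finset.card_le_card ?_).trans (Finset.card_image_le (f := Prod.snd))
  intro t ht
  simp only [Finset.mem_filter, Finset.mem_range] at ht
  obtain ⟨N, hN, h1, h2, hG⟩ := exists_of_not_fill (by omega) ht.2.1
  refine Finset.mem_image.2 ⟨N, Finset.mem_filter.2 ⟨hN, hG⟩, ?_⟩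
  by_contra hne
  have hd := (mem_maxIntervals.1 hN).2.1
  rcases ht.2.2 with h | h
  · omega
  · exact (not_fill_iff hN (t := t + 1) (by omega) (by omega)).2 hG h

open Classical in
/-- If initial and final `A`-intervals do not have property `G`, then the number of maximal
`fill`-intervals is at most one more than that of the inner `A`-intervals without property `G`. -/
theorem card_maxIntervals_fill_le (G : ℕ × ℕ → Prop)
    (hG : ∀ N, G N → 0 < N.1 ∧ N.2 < d) :
    (maxIntervals d (fill d A G)).card ≤
      ((maxIntervals d A).filter fun N => (0 < N.1 ∧ N.2 < d) ∧ ¬ G N).card +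
        if ∃ t ≤ d, ¬ A t then 1 else 0 := by
  -- A filled `A`-interval is not initial and is preceded by a slot outside `A`, so no
  -- `fill`-interval starts inside it.
  have hnot : ∀ L ∈ maxIntervals d (fill d A G), ¬ A L.1 := by
    intro L hL hA
    obtain ⟨h1, h2, h3, h4, -⟩ := mem_maxIntervals.1 hL
    rcases h3 L.1 le_rfl h1 with h | ⟨N, hN, ht, hGN⟩
    · exact h hA
    rw [Finset.mem_Icc] at ht
    have hpos := (hG N hGN).1
    refine h4.resolve_left (by omega) ?_
    rcases Nat.lt_or_ge N.1 L.1 with h | h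
    · exact Or.inr ⟨N, hN, Finset.mem_Icc.2 ⟨by omega, by omega⟩, hGN⟩
    · obtain rfl' : L.1 = N.1 := by omega
      rw [rfl']
      exact Or.inl ((mem_maxIntervals.1 hN).2.2.2.1.resolve_left (by omega))
  split_ifs with hex
  · let F := (maxIntervals d A).filter fun N => (0 < N.1 ∧ N.2 < d) ∧ ¬ G N
    let a := Nat.find hex
    obtain ⟨ha1, ha2⟩ : a ≤ d ∧ ¬ A a := Nat.find_spec hex
    -- The first slot outside `A` accounts for the additional 1; every other start directly follows
    -- an unfilled inner interval.
    have hsub : (maxIntervals d (fill d A G)).image Prod.fst ⊆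
        insert a (F.image fun N => N.2 + 1) := by
      intro t ht
      obtain ⟨L, hL, rfl⟩ := Finset.mem_image.1 ht
      have hA := hnot L hL
      obtain ⟨h1, h2, h3, h4, -⟩ := mem_maxIntervals.1 hL
      have haL : a ≤ L.1 := Nat.find_min' hex ⟨h1.trans h2, hA⟩
      rcases Nat.eq_or_lt_of_le haL with h | h
      · exact Finset.mem_insert.2 (Or.inl h.symm)
      · obtain ⟨N, hN, b1, b2, hGN⟩ := exists_of_not_fill (d := d) (by omega)
          (h4.resolve_left (by omega))
        have hNA := (mem_maxIntervals.1 hN).2.2.1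
        have e : N.2 = L.1 - 1 := by
          by_contra hne
          exact hA (hNA _ (by omega) (by omega))
        have hN0 : a < N.1 := by
          by_contra hlt
          exact ha2 (hNA _ (by omega) (by omega))
        exact Finset.mem_insert_of_mem (Finset.mem_image.2
          ⟨N, Finset.mem_filter.2 ⟨hN, ⟨by omega, by omega⟩, hGN⟩, by omega⟩)
    have hinj : Set.InjOn Prod.fst (maxIntervals d (fill d A G) : Set (ℕ × ℕ)) := by
      intro L hL L' hL' h
      have h1 := (mem_maxIntervals.1 hL).1
      have h1' := (mem_maxIntervals.1 hL').1
      exact maxIntervals_eq hL hL' (t := L.1) le_rfl h1 h.symm.le (h ▸ h1')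
    rw [← Finset.card_image_of_injOn hinj]
    refine (Finset.card_le_card hsub).trans ((Finset.card_insert_le _ _).trans ?_)
    gcongr
    exact Finset.card_image_le
  · push Not at hex
    rw [Finset.card_eq_zero.2]
    · exact Nat.zero_le _
    · rw [Finset.eq_empty_iff_forall_notMem]
      intro L hL
      obtain ⟨h1, h2, -⟩ := mem_maxIntervals.1 hL
      exact hnot L hL (hex _ (h1.trans h2))

end Intervals

/-! ### Charging idle intervals -/

section Charging

/-- The maximal interval `N` of slots with `v ≤ k` contains the slot `t` with `n t + 2 * v t ≤ k`,
with `v t` as small as possible, and `y` is the first slot after `t` with `k - 2 * v t < n y`, or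
`d + 1` if there is none. -/
structure Charged (d : ℕ) (v n : ℕ → ℕ) (k : ℕ) (N : ℕ × ℕ) (t y : ℕ) : Prop where
  mem : N ∈ maxIntervals d (fun s => v s ≤ k)
  left : N.1 ≤ t
  right : t ≤ N.2
  low : n t + 2 * v t ≤ k
  min : ∀ s, N.1 ≤ s → s ≤ N.2 → n s + 2 * v s ≤ k → v t ≤ v s
  lt : t < y
  le : y ≤ d + 1
  reached : y = d + 1 ∨ k - 2 * v t < n y
  off : ∀ s, t ≤ s → s < y → n s ≤ k - 2 * v t

variable {d : ℕ} {v n : ℕ → ℕ}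

open Classical in
/-- The maximal intervals of slots with `v ≤ k` that contain a slot with `n + 2 * v ≤ k`. -/
noncomputable def lowIntervals (d : ℕ) (v n : ℕ → ℕ) (k : ℕ) : Finset (ℕ × ℕ) :=
  (maxIntervals d fun s => v s ≤ k).filter fun N => ∃ t ∈ Finset.Icc N.1 N.2, n t + 2 * v t ≤ k

theorem exists_charged {k : ℕ} {N : ℕ × ℕ} (h : N ∈ lowIntervals d v n k) :
    ∃ p : ℕ × ℕ, Charged d v n k N p.1 p.2 := by
  classical
  obtain ⟨hN, t₀, h1, h2⟩ := Finset.mem_filter.1 h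
  obtain ⟨t, ht, hmin⟩ := Finset.exists_min_image
    ((Finset.Icc N.1 N.2).filter fun t => n t + 2 * v t ≤ k) v
    ⟨t₀, Finset.mem_filter.2 ⟨h1, h2⟩⟩
  simp only [Finset.mem_filter, Finset.mem_Icc, and_imp] at ht hmin
  have hd := (mem_maxIntervals.1 hN).2.1
  have hy : ∃ y, t < y ∧ (y = d + 1 ∨ k - 2 * v t < n y) := ⟨d + 1, by omega, Or.inl rfl⟩
  obtain ⟨y1, y2⟩ := Nat.find_spec hy
  refine ⟨(t, Nat.find hy), hN, ht.1.1, ht.1.2, ht.2, hmin, y1,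
    Nat.find_min' hy ⟨by omega, Or.inl rfl⟩, y2, fun s hs hs' => ?_⟩
  rcases Nat.eq_or_lt_of_le hs with rfl | hlt
  · dsimp only
    omega
  · have := Nat.find_min hy hs'
    dsimp only
    by_contra hc
    exact this ⟨hlt, Or.inr (by omega)⟩

theorem Charged.le_horizon {k t y : ℕ} {N : ℕ × ℕ} (h : Charged d v n k N t y) : t ≤ d :=
  h.right.trans (mem_maxIntervals.1 h.mem).2.1

/-- Domination gives `K - v t₁ - v t₂ < n s` for some `s` between, but `n s` is at most the common
value of `k₁ - 2 * v t₁` and `k₂ - 2 * v t₂`, whose average is at most `K - v t₁ - v t₂`. This is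
the reason for the factor 2 in `low`. The condition `1 ≤ K` provides `v t₁ < K`. -/
theorem Charged.not_separated (hd : Dominates d v n) {k₁ k₂ t₁ t₂ y K b : ℕ} {N₁ N₂ : ℕ × ℕ}
    (h₁ : Charged d v n k₁ N₁ t₁ y) (h₂ : Charged d v n k₂ N₂ t₂ y)
    (he : k₁ - 2 * v t₁ = k₂ - 2 * v t₂) (hK : 1 ≤ K) (hK₁ : k₁ ≤ K) (hK₂ : k₂ ≤ K)
    (ht₁ : t₁ < b) (ht₂ : b < t₂) (hb : K < v b) : False := by
  have a1 := h₁.low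
  have a2 := h₂.low
  have a3 := h₂.lt
  obtain ⟨s, h3, h4, h5⟩ := hd.between K t₁ b t₂ ht₁ ht₂ h₂.le_horizon (by omega) (by omega) hb
  have a4 := h₁.off s h3.le (by omega)
  omega

/-- If `t₁` lies in `N₂`, minimality gives `v t₂ ≤ v t₁`, whereas `he` and `k₁ < k₂` force `v t₁ < v
t₂`. Otherwise a slot with load above `k₂` separates `t₁` from `t₂`. -/
theorem Charged.not_level_lt (hd : Dominates d v n) {k₁ k₂ t₁ t₂ y : ℕ} {N₁ N₂ : ℕ × ℕ}
    (h₁ : Charged d v n k₁ N₁ t₁ y) (h₂ : Charged d v n k₂ N₂ t₂ y)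
    (he : k₁ - 2 * v t₁ = k₂ - 2 * v t₂) : ¬ k₁ < k₂ := by
  intro hlt
  have a1 := h₁.low
  have a2 := h₂.low
  have hd1 := h₁.le_horizon
  obtain ⟨N, hN, b1, b2⟩ := exists_mem_maxIntervals (A := fun s => v s ≤ k₂) hd1
    (show v t₁ ≤ k₂ by omega)
  by_cases hNN : N = N₂
  · subst hNN
    have := h₂.min t₁ b1 b2 (by omega)
    omega
  · have hle : ∀ {x}, ¬ x ≤ k₂ → k₂ < x := fun h => not_le.1 h
    rcases le_total t₁ t₂ with h | h
    · obtain ⟨c1, c2, -⟩ := maxIntervals_sep hN h₂.mem hNN b1 b2 h₂.left h₂.right h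
      have := h₂.left
      exact Charged.not_separated hd h₁ h₂ he (by omega) hlt.le le_rfl (by omega) (by omega)
        (hle c2)
    · obtain ⟨c1, c2, -⟩ := maxIntervals_sep h₂.mem hN (Ne.symm hNN) h₂.left h₂.right b1 b2 h
      have := h₂.right
      exact Charged.not_separated hd h₂ h₁ he.symm (by omega) le_rfl hlt.le (by omega) (by omega)
        (hle c2)

/-- The levels agree, so distinct intervals are separated by a slot above their level. Only on level
0 is this possible, where no slot is strictly below the level and `between` does not apply. -/
theorem Charged.eq_zero (hd : Dominates d v n) {k₁ k₂ t₁ t₂ y : ℕ} {N₁ N₂ : ℕ × ℕ}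
    (h₁ : Charged d v n k₁ N₁ t₁ y) (h₂ : Charged d v n k₂ N₂ t₂ y)
    (he : k₁ - 2 * v t₁ = k₂ - 2 * v t₂) (hne : k₁ = k₂ → N₁ ≠ N₂) : k₁ = 0 ∧ k₂ = 0 := by
  obtain rfl : k₁ = k₂ :=
    le_antisymm (not_lt.1 (h₂.not_level_lt hd h₁ he.symm)) (not_lt.1 (h₁.not_level_lt hd h₂ he))
  rw [and_self]
  by_contra hk
  have hNN := hne rfl
  rcases le_total t₁ t₂ with h | h
  · obtain ⟨c1, c2, -⟩ := maxIntervals_sep h₁.mem h₂.mem hNN h₁.left h₁.right h₂.left h₂.right h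
    have := h₂.left
    have := h₁.right
    exact Charged.not_separated hd h₁ h₂ he (by omega) le_rfl le_rfl (by omega) (by omega)
      (not_le.1 c2)
  · obtain ⟨c1, c2, -⟩ := maxIntervals_sep h₂.mem h₁.mem hNN.symm h₂.left h₂.right h₁.left h₁.right h
    have := h₁.left
    have := h₂.right
    exact Charged.not_separated hd h₂ h₁ he.symm (by omega) le_rfl le_rfl (by omega) (by omega)
      (not_le.1 c2)

/-- The middle interval starts right after a busy slot, so `between_end` finds a slot with `1 ≤ n`
before `t₃`, although `n` vanishes from `t₁` up to `y`. -/
theorem Charged.not_three (hd : Dominates d v n) {t₁ t₂ t₃ y : ℕ} {N₁ N₂ N₃ : ℕ × ℕ}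
    (h₁ : Charged d v n 0 N₁ t₁ y) (h₂ : Charged d v n 0 N₂ t₂ y) (h₃ : Charged d v n 0 N₃ t₃ y)
    (h12 : N₁ ≠ N₂) (h23 : N₂ ≠ N₃) (ht12 : t₁ ≤ t₂) (ht23 : t₂ ≤ t₃) : False := by
  obtain ⟨c1, -, c2⟩ := maxIntervals_sep h₁.mem h₂.mem h12 h₁.left h₁.right h₂.left h₂.right ht12
  obtain ⟨d1, d2, -⟩ := maxIntervals_sep h₂.mem h₃.mem h23 h₂.left h₂.right h₃.left h₃.right ht23
  obtain ⟨e1, -, e3, -⟩ := mem_maxIntervals.1 h₂.mem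
  have a3 := h₃.low
  have b1 := h₁.right
  have b3 := h₃.left
  obtain ⟨s, f1, f2, f3⟩ := hd.between_end N₂.1 (N₂.2 + 1) t₃ (by omega)
    (Nat.le_zero.1 (e3 _ le_rfl e1)) (not_le.1 c2) (by omega) (by omega) h₃.le_horizon (by omega)
    (not_le.1 d2)
  have := h₁.off s (by omega) (by have := h₃.lt; omega)
  omega

/-- At most two low intervals are charged to the same pair. -/
theorem card_charged_le_two (hd : Dominates d v n) (B : Finset (Σ _ : ℕ, ℕ × ℕ))
    (g : (Σ _ : ℕ, ℕ × ℕ) → ℕ × ℕ) (hB : ∀ p ∈ B, Charged d v n p.1 p.2 (g p).1 (g p).2)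
    (c : Σ _ : ℕ, ℕ) (hc : ∀ p ∈ B, (⟨p.1 - 2 * v (g p).1, (g p).2⟩ : Σ _ : ℕ, ℕ) = c) :
    B.card ≤ 2 := by
  by_contra! hcard
  obtain ⟨p, hp, q, hq, r, hr, hpq, hpr, hqr⟩ := Finset.two_lt_card.1 hcard
  have two : ∀ p ∈ B, ∀ q ∈ B, p ≠ q → p.1 = 0 ∧ q.1 = 0 ∧ p.2 ≠ q.2 ∧ (g p).2 = (g q).2 := by
    rintro ⟨k, N⟩ hp ⟨k', N'⟩ hq hpq
    have e := (hc _ hp).trans (hc _ hq).symm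
    simp only [Sigma.mk.injEq, heq_eq_eq] at e
    have h1 := hB _ hp
    have h2 := hB _ hq
    rw [← e.2] at h2
    have hne : k = k' → N ≠ N' := by
      rintro rfl rfl
      exact hpq rfl
    obtain ⟨h3, h4⟩ := h1.eq_zero hd h2 e.1 hne
    exact ⟨h3, h4, hne (h3.trans h4.symm), e.2⟩
  have key : ∀ p ∈ B, ∀ q ∈ B, ∀ r ∈ B, p ≠ q → q ≠ r → (g p).1 ≤ (g q).1 → (g q).1 ≤ (g r).1 →
      False := by
    intro p hp q hq r hr hpq hqr h1 h2
    obtain ⟨a1, a2, a3, a4⟩ := two p hp q hq hpq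
    obtain ⟨b1, b2, b3, b4⟩ := two q hq r hr hqr
    have c1 := hB p hp
    have c2 := hB q hq
    have c3 := hB r hr
    rw [a1] at c1
    rw [a2, ← a4] at c2
    rw [b2, ← b4, ← a4] at c3
    exact c1.not_three hd c2 c3 a3 b3 h1 h2
  rcases le_total (g p).1 (g q).1 with h1 | h1 <;> rcases le_total (g q).1 (g r).1 with h2 | h2 <;>
    rcases le_total (g p).1 (g r).1 with h3 | h3
  · exact key p hp q hq r hr hpq hqr h1 h2
  · exact key p hp q hq r hr hpq hqr h1 h2
  · exact key p hp r hr q hq hpr hqr.symm h3 h2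
  · exact key r hr p hp q hq hpr.symm hpq h3 h1
  · exact key q hq p hp r hr hpq.symm hpr h1 h3
  · exact key q hq r hr p hp hqr hpr.symm h2 h3
  · exact key r hr q hq p hp hqr.symm hpq.symm h2 h1
  · exact key r hr q hq p hp hqr.symm hpq.symm h2 h1

open Classical in
/-- The number of low intervals is at most twice the number of maximal intervals of slots with
`n ≤ k`, over all levels `k`. -/
theorem sum_card_lowIntervals_le (hd : Dominates d v n) (m : ℕ) :
    ∑ k ∈ Finset.range m, (lowIntervals d v n k).card ≤
      2 * ∑ k ∈ Finset.range m, ((Finset.range (d + 1)).filter fun e =>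
        n e ≤ k ∧ (e = d ∨ k < n (e + 1))).card := by
  rw [← Finset.card_sigma, ← Finset.card_sigma]
  let B := (Finset.range m).sigma fun k => lowIntervals d v n k
  have hex : ∀ p : Σ _ : ℕ, ℕ × ℕ, ∃ q : ℕ × ℕ, p ∈ B → Charged d v n p.1 p.2 q.1 q.2 := by
    intro p
    by_cases hp : p ∈ B
    · obtain ⟨q, hq⟩ := exists_charged (Finset.mem_sigma.1 hp).2
      exact ⟨q, fun _ => hq⟩
    · exact ⟨(0, 0), fun h => absurd h hp⟩
  choose g hg using hex
  -- The charge goes to `y - 1`, the last slot of the off-stretch; `y = d + 1` corresponds to a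
  -- stretch ending at `d`.
  refine Finset.card_le_mul_card_image_of_maps_to
    (f := fun p => (⟨p.1 - 2 * v (g p).1, (g p).2 - 1⟩ : Σ _ : ℕ, ℕ)) ?_ 2 ?_
  · intro p hp
    have h := hg p hp
    have h1 := h.lt
    have h2 := h.le
    have h3 := h.off ((g p).2 - 1) (by omega) (by omega)
    have hm := Finset.mem_range.1 (Finset.mem_sigma.1 hp).1
    simp only [Finset.mem_sigma, Finset.mem_range, Finset.mem_filter]
    refine ⟨by omega, by omega, h3, ?_⟩
    rw [Nat.sub_add_cancel (by omega)]
    exact h.reached.imp_left fun h => by omega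
  · rintro ⟨c1, c2⟩ -
    refine card_charged_le_two hd _ g (fun p hp => hg p (Finset.mem_filter.1 hp).1) ⟨c1, c2 + 1⟩ ?_
    intro p hp
    obtain ⟨h1, h2⟩ := Finset.mem_filter.1 hp
    have := (hg p h1).lt
    simp only [Sigma.mk.injEq, heq_eq_eq] at h2 ⊢
    omega

open Classical in
theorem card_starts_add_le (k : ℕ) :
    ((Finset.range (d + 1)).filter fun y => (1 ≤ y ∧ n (y - 1) ≤ k ∧ k < n y) ∧
      ∃ s < y, k < n s).card + (if ∃ s ≤ d, k < n s then 1 else 0) ≤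
    ((Finset.range (d + 1)).filter fun y => k < n y ∧ (y = 0 ∨ n (y - 1) ≤ k)).card := by
  split_ifs with hex
  · obtain ⟨h1, h2⟩ := Nat.find_spec hex
    have hmin : ∀ s, s < Nat.find hex → n s ≤ k := fun s hs => by
      have := Nat.find_min hex hs
      push Not at this
      exact this (by omega)
    have hmem : Nat.find hex ∈
        (Finset.range (d + 1)).filter fun y => k < n y ∧ (y = 0 ∨ n (y - 1) ≤ k) := by
      simp only [Finset.mem_filter, Finset.mem_range]
      refine ⟨by omega, h2, ?_⟩
      rcases Nat.eq_zero_or_pos (Nat.find hex) with h0 | h0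
      · exact Or.inl h0
      · exact Or.inr (hmin _ (by omega))
    rw [← Finset.card_erase_add_one hmem]
    gcongr
    intro y hy
    simp only [Finset.mem_filter, Finset.mem_range, Finset.mem_erase] at hy ⊢
    refine ⟨?_, hy.1, hy.2.1.2.2, Or.inr hy.2.1.2.1⟩
    rintro rfl
    obtain ⟨s, hs, hk⟩ := hy.2.2
    have := hmin s hs
    omega
  · rw [add_zero]
    apply Finset.card_le_card
    intro y hy
    simp only [Finset.mem_filter, Finset.mem_range] at hy ⊢
    exact ⟨hy.1, hy.2.1.2.2, Or.inr hy.2.1.2.1⟩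

open Classical in
/-- The number of low intervals strictly inside the horizon, together with the number of levels
reached by `v`, is at most twice the number of maximal intervals of slots with `k < n`, over all
levels `k`. -/
theorem sum_card_inner_lowIntervals_le (hd : Dominates d v n) (m : ℕ) :
    ∑ k ∈ Finset.range m, (((lowIntervals d v n k).filter fun N => 0 < N.1 ∧ N.2 < d).card +
        if ∃ s ≤ d, k < v s then 1 else 0) ≤
      2 * ∑ k ∈ Finset.range m, ((Finset.range (d + 1)).filter fun y =>
        k < n y ∧ (y = 0 ∨ n (y - 1) ≤ k)).card := by
  let B := (Finset.range m).sigma fun k => (lowIntervals d v n k).filter fun N => 0 < N.1 ∧ N.2 < d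
  have hBmem : ∀ {p : Σ _ : ℕ, ℕ × ℕ}, p ∈ B →
      p.1 < m ∧ p.2 ∈ lowIntervals d v n p.1 ∧ 0 < p.2.1 ∧ p.2.2 < d := fun hp => by
    obtain ⟨h1, h2⟩ := Finset.mem_sigma.1 hp
    exact ⟨Finset.mem_range.1 h1, Finset.mem_filter.1 h2⟩
  have hex : ∀ p : Σ _ : ℕ, ℕ × ℕ, ∃ q : ℕ × ℕ, p ∈ B → Charged d v n p.1 p.2 q.1 q.2 := by
    intro p
    by_cases hp : p ∈ B
    · obtain ⟨q, hq⟩ := exists_charged (hBmem hp).2.1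
      exact ⟨q, fun _ => hq⟩
    · exact ⟨(0, 0), fun h => absurd h hp⟩
  choose g hg using hex
  have hedge : ∀ p ∈ B, p.1 < v (p.2.1 - 1) ∧ p.1 < v (p.2.2 + 1) := by
    intro p hp
    obtain ⟨-, -, h1, h2⟩ := hBmem hp
    obtain ⟨-, -, -, h3, h4⟩ := mem_maxIntervals.1 (hg p hp).mem
    exact ⟨not_le.1 (h3.resolve_left (by omega)), not_le.1 (h4.resolve_left (by omega))⟩
  -- By `before`, `n` exceeds the charged level already earlier, so these charges miss the first
  -- rise on that level.
  have hinner : (B.filter fun p => (g p).2 ≤ d).card ≤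
      2 * ∑ k ∈ Finset.range m, ((Finset.range (d + 1)).filter fun y =>
        (1 ≤ y ∧ n (y - 1) ≤ k ∧ k < n y) ∧ ∃ s < y, k < n s).card := by
    rw [← Finset.card_sigma]
    refine Finset.card_le_mul_card_image_of_maps_to
      (f := fun p => (⟨p.1 - 2 * v (g p).1, (g p).2⟩ : Σ _ : ℕ, ℕ)) ?_ 2 ?_
    · intro p hp
      obtain ⟨hp, hy⟩ := Finset.mem_filter.1 hp
      have h := hg p hp
      obtain ⟨hm, -, hN1, hN2⟩ := hBmem hp
      have h1 := h.lt
      have h3 := h.off ((g p).2 - 1) (by omega) (by omega)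
      have h4 := h.reached.resolve_left (by omega)
      have h5 := h.low
      have h6 := h.left
      obtain ⟨s, hs, hs'⟩ := hd.before p.1 (p.2.1 - 1) (g p).1 (by omega) h.le_horizon (by omega)
        (hedge p hp).1
      simp only [Finset.mem_sigma, Finset.mem_range, Finset.mem_filter]
      exact ⟨by omega, by omega, ⟨by omega, h3, h4⟩, s, by omega, by omega⟩
    · rintro ⟨c1, c2⟩ -
      refine card_charged_le_two hd _ g
        (fun p hp => hg p (Finset.mem_filter.1 (Finset.mem_filter.1 hp).1).1) ⟨c1, c2⟩ ?_
      intro p hp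
      exact (Finset.mem_filter.1 hp).2
  -- Without a later rise, `after` excludes positive levels, and `after_end` excludes a second
  -- interval on level 0.
  have hlast : (B.filter fun p => ¬ (g p).2 ≤ d).card ≤ 1 := by
    have hzero : ∀ p ∈ B, ¬ (g p).2 ≤ d → p.1 = 0 := by
      intro p hp hy
      by_contra hk
      have h := hg p hp
      obtain ⟨hm, -, hN1, hN2⟩ := hBmem hp
      have h5 := h.low
      have h6 := h.right
      obtain ⟨s, hs, hs', hs''⟩ := hd.after p.1 (g p).1 (p.2.2 + 1) (by omega) (by omega) (by omega)
        (hedge p hp).2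
      have := h.off s hs.le (by omega)
      omega
    have key : ∀ p ∈ B, ∀ q ∈ B, ¬ (g p).2 ≤ d → p.1 = 0 → q.1 = 0 → p.2 ≠ q.2 →
        (g p).1 ≤ (g q).1 → False := by
      intro p hp q hq hy hp0 hq0 hne hle
      have h1 := hg p hp
      have h2 := hg q hq
      have e1 := (hedge q hq).1
      have e2 := (hedge q hq).2
      obtain ⟨-, -, hN1, hN2⟩ := hBmem hq
      rw [hp0] at h1
      rw [hq0] at h2 e1 e2
      have c1 := (maxIntervals_sep h1.mem h2.mem hne h1.left h1.right h2.left h2.right hle).1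
      obtain ⟨b1, -, b3, -⟩ := mem_maxIntervals.1 h2.mem
      obtain ⟨s, hs, hs', hs''⟩ := hd.after_end q.2.1 (q.2.2 + 1) (by omega)
        (Nat.le_zero.1 (b3 _ le_rfl b1)) e1 (by omega) (by omega) e2
      have a1 := h1.right
      have := h1.off s (by omega) (by omega)
      omega
    rw [Finset.card_le_one]
    intro p hp q hq
    obtain ⟨hp, hpy⟩ := Finset.mem_filter.1 hp
    obtain ⟨hq, hqy⟩ := Finset.mem_filter.1 hq
    have hp0 := hzero p hp hpy
    have hq0 := hzero q hq hqy
    by_contra hne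
    have hne' : p.2 ≠ q.2 := fun h => hne (by
      cases p
      cases q
      simp only at h hp0 hq0
      rw [h, hp0, hq0])
    rcases le_total (g p).1 (g q).1 with h | h
    · exact key p hp q hq hpy hp0 hq0 hne' h
    · exact key q hq p hp hqy hq0 hp0 hne'.symm h
  have hsplit : B.card = (B.filter fun p => (g p).2 ≤ d).card +
      (B.filter fun p => ¬ (g p).2 ≤ d).card :=
    (Finset.card_filter_add_card_filter_not _).symm
  have hlevels : ∀ k, (if ∃ s ≤ d, k < v s then 1 else 0) ≤ if ∃ s ≤ d, k < n s then 1 else 0 := by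
    intro k
    split_ifs with h1 h2 h2
    · exact le_rfl
    · obtain ⟨b, hb, hk⟩ := h1
      obtain ⟨s, hs, hs'⟩ := hd.somewhere k b hb hk
      exact absurd ⟨s, hs, hs'⟩ h2
    · exact Nat.zero_le _
    · exact le_rfl
  -- The uncharged first rises count twice on the right: once for the levels reached by `v`, once
  -- for the possible exceptional interval, whose presence implies that some level is reached by
  -- `n`.
  have hone : (B.filter fun p => ¬ (g p).2 ≤ d).card ≤
      ∑ k ∈ Finset.range m, if ∃ s ≤ d, k < n s then 1 else 0 := by
    rcases Finset.eq_empty_or_nonempty (B.filter fun p => ¬ (g p).2 ≤ d) with h | ⟨p, hp⟩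
    · rw [h]
      exact Nat.zero_le _
    · obtain ⟨hp, -⟩ := Finset.mem_filter.1 hp
      obtain ⟨hm, -, hN1, hN2⟩ := hBmem hp
      have h1 : (if ∃ s ≤ d, p.1 < v s then 1 else 0) = 1 :=
        if_pos ⟨p.2.2 + 1, by omega, (hedge p hp).2⟩
      exact (hlast.trans (h1.symm.le.trans (hlevels p.1))).trans (Finset.single_le_sum
        (f := fun k => if ∃ s ≤ d, k < n s then 1 else 0) (fun _ _ => Nat.zero_le _)
        (Finset.mem_range.2 hm))
  have hB : B.card = ∑ k ∈ Finset.range m,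
      ((lowIntervals d v n k).filter fun N => 0 < N.1 ∧ N.2 < d).card := Finset.card_sigma _ _
  rw [Finset.sum_add_distrib, ← hB, hsplit]
  have h1 := Finset.sum_le_sum fun k (_ : k ∈ Finset.range m) => hlevels k
  have h2 := Finset.sum_le_sum fun k (_ : k ∈ Finset.range m) => card_starts_add_le (d := d) (n := n) k
  rw [Finset.sum_add_distrib] at h2
  omega

end Charging

/-! ### Levels of a number of processors -/

section Levels

variable {m : ℕ}

open Classical in
/-- The number of processors that are on in slot `t`. -/
noncomputable def countOn (on : Fin m → ℕ → Prop) (t : ℕ) : ℕ :=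
  (Finset.univ.filter fun k => on k t).card

variable (on : Fin m → ℕ → Prop) (d : ℕ)

theorem vol_le_countOn {J : Type*} {S : Assignment m J} (h : ∀ k t, Busy S k t → on k t) (t : ℕ) :
    vol S t ≤ countOn on t := by
  classical
  unfold vol countOn
  apply Finset.card_le_card
  intro k hk
  simp only [Finset.mem_filter, Finset.mem_univ, true_and] at hk ⊢
  exact h k t hk

theorem sum_card_on [∀ k t, Decidable (on k t)] (T : Finset ℕ) :
    ∑ k, (T.filter fun t => on k t).card = ∑ t ∈ T, countOn on t := by
  simp only [countOn, Finset.card_filter]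
  rw [Finset.sum_comm]
  congr!

theorem sum_card_level (T : Finset ℕ) (P : ℕ → ℕ → Prop) [∀ k t, Decidable (P k t)] :
    ∑ k ∈ Finset.range m, (T.filter fun t => P k t).card =
      ∑ t ∈ T, ((Finset.range m).filter fun k => P k t).card := by
  simp only [Finset.card_filter]
  exact Finset.sum_comm

theorem card_level_le (a b : ℕ) (P : ℕ → Prop) [DecidablePred P] (h : ∀ k < m, P k → a ≤ k ∧ k < b) :
    ((Finset.range m).filter P).card ≤ b - a := by
  rw [← Nat.card_Ico]
  apply Finset.card_le_card
  intro k hk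
  obtain ⟨h1, h2⟩ := Finset.mem_filter.1 hk
  exact Finset.mem_Ico.2 (h k (Finset.mem_range.1 h1) h2)

open Classical in
theorem countOn_sub_le (s t : ℕ) :
    countOn on t - countOn on s ≤ (Finset.univ.filter fun k => on k t ∧ ¬ on k s).card := by
  refine (Finset.le_card_sdiff _ _).trans (Finset.card_le_card ?_)
  intro k hk
  simpa using hk

open Classical in
-- At each slot the number of starting levels is the increase of `countOn`, and at least that many
-- processors turn on.
theorem sum_level_starts_le :
    ∑ k ∈ Finset.range m, ((Finset.range (d + 1)).filter fun y =>
        k < countOn on y ∧ (y = 0 ∨ countOn on (y - 1) ≤ k)).card ≤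
      ∑ k, ((Finset.range (d + 1)).filter fun y => on k y ∧ (y = 0 ∨ ¬ on k (y - 1))).card := by
  rw [sum_card_level _ fun k y => k < countOn on y ∧ (y = 0 ∨ countOn on (y - 1) ≤ k),
    sum_card_on fun k y => on k y ∧ (y = 0 ∨ ¬ on k (y - 1))]
  refine Finset.sum_le_sum fun y _ => ?_
  rcases Nat.eq_zero_or_pos y with rfl | hy
  · refine (card_level_le 0 (countOn on 0) _ fun k _ h => ⟨Nat.zero_le k, h.1⟩).trans ?_
    simp [countOn]
  · refine (card_level_le (countOn on (y - 1)) (countOn on y) _ fun k _ h =>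
      ⟨h.2.resolve_left hy.ne', h.1⟩).trans ((countOn_sub_le on _ _).trans ?_)
    apply Finset.card_le_card
    intro k hk
    simp only [Finset.mem_filter] at hk ⊢
    exact ⟨hk.1, hk.2.1, Or.inr hk.2.2⟩

open Classical in
theorem sum_level_ends_le :
    ∑ k ∈ Finset.range m, ((Finset.range (d + 1)).filter fun e =>
        countOn on e ≤ k ∧ (e = d ∨ k < countOn on (e + 1))).card ≤
      ∑ k, ((Finset.range (d + 1)).filter fun e => ¬ on k e ∧ (e = d ∨ on k (e + 1))).card := by
  rw [sum_card_level _ fun k e => countOn on e ≤ k ∧ (e = d ∨ k < countOn on (e + 1)),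
    sum_card_on fun k e => ¬ on k e ∧ (e = d ∨ on k (e + 1))]
  refine Finset.sum_le_sum fun e _ => ?_
  by_cases he : e = d
  · refine (card_level_le (countOn on e) m _ fun k hk h => ⟨h.1, hk⟩).trans ?_
    have := Finset.card_filter_add_card_filter_not (s := (Finset.univ : Finset (Fin m)))
      (fun k => on k e)
    rw [Finset.card_univ, Fintype.card_fin] at this
    simp only [he, true_or, and_true, countOn] at this ⊢
    omega
  · refine (card_level_le (countOn on e) (countOn on (e + 1)) _ fun k _ h =>
      ⟨h.1, h.2.resolve_left he⟩).trans ((countOn_sub_le on _ _).trans ?_)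
    apply Finset.card_le_card
    intro k hk
    simp only [Finset.mem_filter] at hk ⊢
    exact ⟨hk.1, hk.2.2, Or.inr hk.2.1⟩

end Levels

open Classical in
theorem sum_min_len_eq {q : ℝ} (F : Finset (ℕ × ℕ)) (G : ℕ × ℕ → Prop)
    (h : ∀ N ∈ F, G N ↔ (len N : ℝ) ≤ q) : ∑ N ∈ F, min (len N : ℝ) q =
      ((∑ N ∈ F.filter G, len N : ℕ) : ℝ) + q * (F.filter fun N => ¬ G N).card := by
  rw [← Finset.sum_filter_add_sum_filter_not F G, Nat.cast_sum, mul_comm, ← nsmul_eq_mul,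
    ← Finset.sum_const]
  congr 1
  · refine Finset.sum_congr rfl fun N hN => ?_
    obtain ⟨h1, h2⟩ := Finset.mem_filter.1 hN
    exact min_eq_left ((h N h1).1 h2)
  · refine Finset.sum_congr rfl fun N hN => ?_
    obtain ⟨h1, h2⟩ := Finset.mem_filter.1 hN
    exact min_eq_right (not_le.1 fun hle => h2 ((h N h1).2 hle)).le

/-! ### Upper bounds for the schedule of the algorithm -/

section Upper

variable {d m : ℕ} {v n : ℕ → ℕ}

open Classical in
-- A low interval pays `q`; any other pays its length, and all its slots satisfy `k < n t + 2 * v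
-- t`.
theorem sum_min_le {q : ℝ} (hq : 0 ≤ q) (k : ℕ) (G : ℕ × ℕ → Prop) [DecidablePred G] :
    ∑ N ∈ (maxIntervals d fun t => v t ≤ k).filter G, min (len N : ℝ) q ≤
      (((Finset.range (d + 1)).filter fun t => v t ≤ k ∧ k < n t + 2 * v t).card : ℝ) +
        q * ((lowIntervals d v n k).filter G).card := by
  have h1 : ∀ N ∈ (maxIntervals d fun t => v t ≤ k).filter G, min (len N : ℝ) q ≤
      ∑ t ∈ Finset.Icc N.1 N.2, (if k < n t + 2 * v t then (1 : ℝ) else 0) +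
        if N ∈ lowIntervals d v n k then q else 0 := by
    intro N hN
    split_ifs with hlow
    · refine (min_le_right _ _).trans (le_add_of_nonneg_left (Finset.sum_nonneg fun t _ => ?_))
      split_ifs <;> norm_num
    · refine (min_le_left _ _).trans ?_
      rw [add_zero, len_eq_card, Finset.sum_congr rfl (g := fun _ => (1 : ℝ))]
      · simp
      · intro t ht
        rw [if_pos]
        by_contra h
        exact hlow (Finset.mem_filter.2 ⟨(Finset.mem_filter.1 hN).1, t, ht, not_lt.1 h⟩)
  refine (Finset.sum_le_sum h1).trans ?_
  rw [Finset.sum_add_distrib]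
  gcongr
  · refine (Finset.sum_le_sum_of_subset_of_nonneg (Finset.filter_subset _ _) fun N _ _ =>
      Finset.sum_nonneg fun t _ => ?_).trans ?_
    · split_ifs <;> norm_num
    · rw [sum_maxIntervals, ← Finset.sum_filter, Finset.filter_filter, Finset.sum_const,
        nsmul_eq_mul, mul_one]
  · rw [← Finset.sum_filter, Finset.sum_const, nsmul_eq_mul, mul_comm]
    gcongr
    intro N hN
    simp only [Finset.mem_filter] at hN ⊢
    exact ⟨hN.2, hN.1.2⟩

open Classical in
theorem sum_card_paid_le : ∑ k ∈ Finset.range m,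
    ((Finset.range (d + 1)).filter fun t => v t ≤ k ∧ k < n t + 2 * v t).card ≤
      ∑ t ∈ Finset.range (d + 1), (n t + v t) := by
  rw [sum_card_level _ fun k t => v t ≤ k ∧ k < n t + 2 * v t]
  refine Finset.sum_le_sum fun t _ => ?_
  exact (card_level_le (v t) (n t + 2 * v t) _ fun k _ h => h).trans (by omega)

open Classical in
theorem sum_card_busy_le : ∑ k ∈ Finset.range m,
    ((Finset.range (d + 1)).filter fun t => ¬ v t ≤ k).card ≤ ∑ t ∈ Finset.range (d + 1), v t := by
  rw [sum_card_level _ fun k t => ¬ v t ≤ k]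
  refine Finset.sum_le_sum fun t _ => ?_
  exact card_level_le 0 (v t) _ fun k _ h => ⟨Nat.zero_le k, not_le.1 h⟩

variable {J : Type*} [Fintype J] {I : Instance J} {S : Assignment I.procs J}

open Classical in
theorem Instance.costs_le_of_stair (hS : I.Feasible S) (hstair : Stair S) (n : ℕ → ℕ) :
    I.costs S ≤ I.totalVolume + ∑ t ∈ I.slots, ((n t : ℝ) + vol S t) +
      I.wake * ∑ k ∈ Finset.range I.procs, (lowIntervals I.horizon (vol S) n k).card := by
  have hk : I.costs S = ∑ k ∈ Finset.range I.procs,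
      ((((Finset.range (I.horizon + 1)).filter fun t => ¬ vol S t ≤ k).card : ℝ) +
        ∑ N ∈ maxIntervals I.horizon (fun t => vol S t ≤ k), min (len N : ℝ) I.wake) := by
    rw [Finset.sum_range, Instance.costs]
    refine Finset.sum_congr rfl fun k _ => ?_
    simp only [hstair.busy_iff, not_lt, ← Nat.cast_sum, sum_len_maxIntervals, not_le]
  have h1 : ∀ k ∈ Finset.range I.procs,
      ((((Finset.range (I.horizon + 1)).filter fun t => ¬ vol S t ≤ k).card : ℝ) +
        ∑ N ∈ maxIntervals I.horizon (fun t => vol S t ≤ k), min (len N : ℝ) I.wake) ≤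
      (((Finset.range (I.horizon + 1)).filter fun t => ¬ vol S t ≤ k).card : ℝ) +
      ((((Finset.range (I.horizon + 1)).filter fun t =>
        vol S t ≤ k ∧ k < n t + 2 * vol S t).card : ℝ) +
        I.wake * (lowIntervals I.horizon (vol S) n k).card) := by
    intro k _
    have := sum_min_le (d := I.horizon) (v := vol S) (n := n) I.wake_nonneg k fun _ => True
    simp only [Finset.filter_true] at this
    gcongr
  rw [hk]
  refine (Finset.sum_le_sum h1).trans ?_
  rw [Finset.sum_add_distrib, Finset.sum_add_distrib, ← add_assoc, ← Finset.mul_sum,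
    ← hS.sum_vol]
  have h2 := sum_card_busy_le (d := I.horizon) (m := I.procs) (v := vol S)
  have h3 := sum_card_paid_le (d := I.horizon) (m := I.procs) (v := vol S) (n := n)
  push_cast
  gcongr
  · exact_mod_cast h2
  · exact_mod_cast h3

open Classical in
-- Initial and final idle intervals are free. Each long inner one causes one wake-up, and the first
-- wake-up of each processor in use gives the indicator term.
theorem Instance.energy_le_of_stair (hS : I.Feasible S) (hstair : Stair S) (n : ℕ → ℕ) :
    I.energy (I.onRule S) ≤ I.totalVolume + ∑ t ∈ I.slots, ((n t : ℝ) + vol S t) +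
      I.wake * ∑ k ∈ Finset.range I.procs, (((lowIntervals I.horizon (vol S) n k).filter
        fun N => 0 < N.1 ∧ N.2 < I.horizon).card +
          if ∃ s ≤ I.horizon, k < vol S s then 1 else 0) := by
  obtain ⟨G, hG⟩ : ∃ G : ℕ × ℕ → Prop, ∀ N, G N ↔
    (0 < N.1 ∧ N.2 < I.horizon) ∧ (len N : ℝ) ≤ I.wake := ⟨_, fun _ => Iff.rfl⟩
  have hon : ∀ k : Fin I.procs, I.onRule S k = fill I.horizon (fun t => vol S t ≤ k.val) G := by
    intro k
    funext t
    simp only [Instance.onRule, fill, hstair.busy_iff, not_lt, not_le, hG, and_assoc]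
  have h0 : I.energy (I.onRule S) = ∑ k ∈ Finset.range I.procs,
      ∑ N ∈ maxIntervals I.horizon (fill I.horizon (fun t => vol S t ≤ k) G),
        ((len N : ℝ) + I.wake) := by
    rw [Finset.sum_range, Instance.energy]
    exact Finset.sum_congr rfl fun k _ => by rw [hon]
  have h1 : ∀ k ∈ Finset.range I.procs,
      ∑ N ∈ maxIntervals I.horizon (fill I.horizon (fun t => vol S t ≤ k) G),
        ((len N : ℝ) + I.wake) ≤
      (((Finset.range (I.horizon + 1)).filter fun t => ¬ vol S t ≤ k).card : ℝ) +
      ((((Finset.range (I.horizon + 1)).filter fun t =>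
        vol S t ≤ k ∧ k < n t + 2 * vol S t).card : ℝ) +
        I.wake * ((((lowIntervals I.horizon (vol S) n k).filter
          fun N => 0 < N.1 ∧ N.2 < I.horizon).card : ℝ) +
            if ∃ s ≤ I.horizon, k < vol S s then 1 else 0)) := by
    intro k _
    have a1 := sum_min_le (d := I.horizon) (v := vol S) (n := n) I.wake_nonneg k
      fun N => 0 < N.1 ∧ N.2 < I.horizon
    have a2 := card_fill_le (d := I.horizon) (A := fun t => vol S t ≤ k) G
    have a3 : (maxIntervals I.horizon (fill I.horizon (fun t => vol S t ≤ k) G)).card ≤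
        ((maxIntervals I.horizon fun t => vol S t ≤ k).filter
          fun N => (0 < N.1 ∧ N.2 < I.horizon) ∧ ¬ G N).card +
            if ∃ s ≤ I.horizon, k < vol S s then 1 else 0 := by
      have h := card_maxIntervals_fill_le (d := I.horizon) (A := fun t => vol S t ≤ k) G
        fun N h => ((hG N).1 h).1
      simp only [not_le] at h
      convert h
    rw [sum_min_len_eq _ G fun N hN =>
      (hG N).trans (and_iff_right (Finset.mem_filter.1 hN).2)] at a1
    have e1 : ((maxIntervals I.horizon fun t => vol S t ≤ k).filter
        fun N => 0 < N.1 ∧ N.2 < I.horizon).filter G =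
        (maxIntervals I.horizon fun t => vol S t ≤ k).filter G := by
      ext N
      simp only [Finset.mem_filter, hG]
      tauto
    have e2 : ((maxIntervals I.horizon fun t => vol S t ≤ k).filter
        fun N => 0 < N.1 ∧ N.2 < I.horizon).filter (fun N => ¬ G N) =
        (maxIntervals I.horizon fun t => vol S t ≤ k).filter
          fun N => (0 < N.1 ∧ N.2 < I.horizon) ∧ ¬ G N := by
      ext N
      simp only [Finset.mem_filter, and_assoc]
    rw [e1, e2] at a1
    rw [Finset.sum_add_distrib, ← Nat.cast_sum, sum_len_maxIntervals, Finset.sum_const,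
      nsmul_eq_mul, mul_comm]
    have a2' : ((((Finset.range (I.horizon + 1)).filter
        (fill I.horizon (fun t => vol S t ≤ k) G)).card : ℕ) : ℝ) ≤ _ := Nat.cast_le.2 a2
    have a3' := mul_le_mul_of_nonneg_left (Nat.cast_le (α := ℝ).2 a3) I.wake_nonneg
    push_cast at a1 a2' a3' ⊢
    simp only [mul_add] at a3' ⊢
    linarith
  rw [h0]
  refine (Finset.sum_le_sum h1).trans ?_
  rw [Finset.sum_add_distrib, Finset.sum_add_distrib, ← add_assoc, ← Finset.mul_sum,
    ← hS.sum_vol]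
  have h2 := sum_card_busy_le (d := I.horizon) (m := I.procs) (v := vol S)
  have h3 := sum_card_paid_le (d := I.horizon) (m := I.procs) (v := vol S) (n := n)
  push_cast
  gcongr
  · exact_mod_cast h2
  · exact_mod_cast h3

end Upper

/-! ### Lower bounds for arbitrary schedules -/

section Lower

variable {J : Type*} [Fintype J] {I : Instance J}

open Classical in
theorem Instance.le_energy (on : Fin I.procs → ℕ → Prop) :
    ∑ t ∈ I.slots, (countOn on t : ℝ) + I.wake * ((∑ k ∈ Finset.range I.procs,
      ((Finset.range (I.horizon + 1)).filter fun y =>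
        k < countOn on y ∧ (y = 0 ∨ countOn on (y - 1) ≤ k)).card : ℕ) : ℝ) ≤ I.energy on := by
  have h1 : I.energy on = ((∑ k, ((Finset.range (I.horizon + 1)).filter fun t => on k t).card : ℕ) : ℝ)
      + I.wake * ((∑ k, (maxIntervals I.horizon (on k)).card : ℕ) : ℝ) := by
    push_cast
    rw [Finset.mul_sum, ← Finset.sum_add_distrib, Instance.energy]
    refine Finset.sum_congr rfl fun k _ => ?_
    rw [Finset.sum_add_distrib, ← Nat.cast_sum, sum_len_maxIntervals, Finset.sum_const,
      nsmul_eq_mul, mul_comm]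
  rw [h1, sum_card_on]
  have h2 := (sum_level_starts_le on I.horizon).trans
    (Finset.sum_le_sum fun k _ => card_starts_le (d := I.horizon) (A := on k))
  have h3 := mul_le_mul_of_nonneg_left (Nat.cast_le (α := ℝ).2 h2) I.wake_nonneg
  rw [← Nat.cast_sum]
  exact add_le_add le_rfl h3

open Classical in
-- Processors stay on in all idle intervals of length at most `q`, initial and final ones included;
-- each remaining idle interval costs `q` and supplies at most one end of an off-stretch.
theorem Instance.le_costs (S : Assignment I.procs J) :
    ∃ on : Fin I.procs → ℕ → Prop, (∀ k t, Busy S k t → on k t) ∧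
      ∑ t ∈ I.slots, (countOn on t : ℝ) + I.wake * ((∑ k ∈ Finset.range I.procs,
        ((Finset.range (I.horizon + 1)).filter fun e =>
          countOn on e ≤ k ∧ (e = I.horizon ∨ k < countOn on (e + 1))).card : ℕ) : ℝ) ≤
        I.costs S := by
  let G : ℕ × ℕ → Prop := fun N => (len N : ℝ) ≤ I.wake
  let on : Fin I.procs → ℕ → Prop := fun k => fill I.horizon (fun t => ¬ Busy S k t) G
  refine ⟨on, fun k t h => Or.inl (not_not.2 h), ?_⟩
  have h1 := sum_level_ends_le on I.horizon
  have h2 := sum_card_on on I.slots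
  have h3 : ∑ t ∈ I.slots, (countOn on t : ℝ) + I.wake * ((∑ k ∈ Finset.range I.procs,
        ((Finset.range (I.horizon + 1)).filter fun e =>
          countOn on e ≤ k ∧ (e = I.horizon ∨ k < countOn on (e + 1))).card : ℕ) : ℝ) ≤
      ∑ k, (((I.slots.filter fun t => on k t).card : ℝ) + I.wake *
        (((Finset.range (I.horizon + 1)).filter fun e =>
          ¬ on k e ∧ (e = I.horizon ∨ on k (e + 1))).card : ℝ)) := by
    rw [Finset.sum_add_distrib, ← Finset.mul_sum, ← Nat.cast_sum, ← Nat.cast_sum, ← Nat.cast_sum,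
      ← h2]
    have := I.wake_nonneg
    gcongr
  refine h3.trans (Finset.sum_le_sum fun k _ => ?_)
  have a1 := card_fill_le (d := I.horizon) (A := fun t => ¬ Busy S k t) G
  have a2 := card_fill_ends_le (d := I.horizon) (A := fun t => ¬ Busy S k t) G
  have a1' : (((I.slots.filter fun t => on k t).card : ℕ) : ℝ) ≤ _ := Nat.cast_le.2 a1
  have a2' := mul_le_mul_of_nonneg_left (Nat.cast_le (α := ℝ).2 a2) I.wake_nonneg
  rw [← Nat.cast_sum, sum_len_maxIntervals, sum_min_len_eq _ G fun _ _ => Iff.rfl]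
  simp only [not_not] at a1'
  push_cast at a1' a2' ⊢
  linarith

end Lower

end PowerDown

/-! ### Combining the upper and lower bounds -/

theorem mainTheorem1 {J : Type*} [Fintype J] (I : PowerDown.Instance J) (hI : I.Solvable) :
    (∃ S : PowerDown.Assignment I.procs J, I.IsPLTRSchedule S) ∧
      ∀ S : PowerDown.Assignment I.procs J, I.IsPLTRSchedule S →
        I.energy (I.onRule S) ≤ 2 * I.optEnergy + (I.totalVolume : ℝ) ∧
        I.costs S ≤ 2 * I.optCosts + (I.totalVolume : ℝ) := by
  classical
  refine ⟨hI.exists_pltr, fun S hS => ?_⟩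
  -- Both schedules process volume `P`, so the total of `vol S` is at most the total on-time of the
  -- competitor.
  have hP : ∀ {S' : PowerDown.Assignment I.procs J} {on : Fin I.procs → ℕ → Prop}, I.Feasible S' →
      (∀ k t, PowerDown.Busy S' k t → on k t) →
      ∑ t ∈ I.slots, ((PowerDown.countOn on t : ℝ) + PowerDown.vol S t) ≤
        2 * ∑ t ∈ I.slots, (PowerDown.countOn on t : ℝ) := by
    intro S' on hS' hon
    have h1 : (∑ t ∈ I.slots, (PowerDown.vol S t : ℝ)) = ∑ t ∈ I.slots, (PowerDown.vol S' t : ℝ) := by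
      exact_mod_cast hS.1.sum_vol.trans hS'.sum_vol.symm
    have h2 : ∑ t ∈ I.slots, (PowerDown.vol S' t : ℝ) ≤
        ∑ t ∈ I.slots, (PowerDown.countOn on t : ℝ) :=
      Finset.sum_le_sum fun t _ => Nat.cast_le.2 (PowerDown.vol_le_countOn on hon t)
    rw [Finset.sum_add_distrib]
    linarith
  constructor
  · obtain ⟨S', on, hS', hon, hE⟩ := (I.isLeast_optEnergy hI).1
    have h1 := PowerDown.Instance.energy_le_of_stair hS.1 hS.2.2 (PowerDown.countOn on)
    have h2 := PowerDown.Instance.le_energy on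
    have h3 := PowerDown.sum_card_inner_lowIntervals_le
      ((hS.dominates hS').mono (PowerDown.vol_le_countOn on hon)) I.procs
    have h4 := mul_le_mul_of_nonneg_left (Nat.cast_le (α := ℝ).2 h3) I.wake_nonneg
    rw [hE]
    have := hP hS' hon
    push_cast at h1 h2 h4
    linarith
  · obtain ⟨S', hS', hE⟩ := (I.isLeast_optCosts hI).1
    obtain ⟨on, hon, h2⟩ := PowerDown.Instance.le_costs S'
    have h1 := PowerDown.Instance.costs_le_of_stair hS.1 hS.2.2 (PowerDown.countOn on)
    have h3 := PowerDown.sum_card_lowIntervals_le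
      ((hS.dominates hS').mono (PowerDown.vol_le_countOn on hon)) I.procs
    have h4 := mul_le_mul_of_nonneg_left (Nat.cast_le (α := ℝ).2 h3) I.wake_nonneg
    rw [hE]
    have := hP hS' hon
    push_cast at h1 h2 h4
    linarith
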